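/- Let $G$ be a finite simple cubic graph without bridges, and let $k$ be a positive integer. (Lists of perfect matchings below may contain repetitions.) (i) Let $\mathcal{C}$ be a collection of pairwise edge-disjoint (equivalently, since $G$ is cubic, pairwise vertex-disjoint) odd cycles in $G$ with $|\mathcal{C}|\leq 5^{k-1}-1$. Then there exist $k-1$ perfect matchings $M_1,\ldots,M_{k-1}$ of $G$ such that for every $C\in\mathcal{C}$ there is $j\in\{1,\ldots,k-1\}$ for which $C$ and $M_j$ have an edge in common. (ii) Let $\omega(G)$ denote the oddness of $G$, that is, the least number of odd cycles amongst all $2$-factors (spanning $2$-regular subgraphs) of $G$. If $\omega(G)\leq 5^{k-1}-1$, then there exist $k$ perfect matchings $M_1,\ldots,M_k$ of $G$ such that the graph obtained from $G$ by deleting all edges of $M_1\cup\cdots\cup M_k$ is bipartite. -/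

import Mathlib

namespace SimpleGraph

variable {V : Type*} {G : SimpleGraph V}

/-- A subgraph of `G` is an odd cycle if it consists of the vertices and edges of
a closed walk of odd length that is a cycle (so its length is at least `3`). -/
def Subgraph.IsOddCycle (C : G.Subgraph) : Prop :=
  ∃ (v : V) (p : G.Walk v v), p.IsCycle ∧ Odd p.length ∧ p.toSubgraph = C

/-- A 2-factor of `G`: a spanning subgraph in which every vertex has degree `2`. -/
def Subgraph.IsTwoFactor (F : G.Subgraph) : Prop :=
  F.IsSpanning ∧ ∀ v : V, (F.neighborSet v).ncard = 2

/-- The oddness of `G`: the least number of odd cycles amongst all 2-factors of `G`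
(the value is `⊤` if `G` has no 2-factor at all). -/
noncomputable def oddness (G : SimpleGraph V) : ℕ∞ :=
  ⨅ (F : G.Subgraph) (_ : F.IsTwoFactor), {C : G.Subgraph | C.IsOddCycle ∧ C ≤ F}.encard

end SimpleGraph

/-!
The two statements follow from a stronger fact: in a cubic bridgeless graph, a *single* perfect
matching meets all members of any family of edge-disjoint odd cycles
(`SimpleGraph.exists_isPerfectMatching_meeting_odd_cycles`). In (i) this matching serves for all
`j`; only for `k = 1` does the bound on the number of cycles matter, as it makes the family empty.
For (ii), take a 2-factor `F`. Its complement is a perfect matching, the odd cycles in `F` are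
disjoint, and a matching that meets them all, deleted together with the complement of `F`, leaves no
odd cycle. For `k ≥ 2` the bound on the oddness only provides some `F`; for `k = 1` it provides an
`F` without odd cycles.

The stronger fact is proved by induction for multigraphs (`Multigraph.oddQuelling`), in the
following form. The cycles are the classes of a partial edge colouring that has even degree in each
colour at each vertex (`EvenColouring`); only classes of odd size have to be met; and the matching
can be required to contain a given edge `e = uv`.

* A three-edge cut with at least two vertices on each side is removed by contracting either side
  (`oddQuelling_of_not_trivial`). The matching of the contraction that contains `e` has one edge
  in the cut, and this edge is prescribed in the other contraction. A colour class of odd size has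
  odd size in one of the two contractions.
* With at most four vertices the matching is written down (`oddQuelling_of_card_lt_five`).
* Otherwise the multigraph is simple and triangle-free (`Irreducible`). Let `x` be a neighbour of
  `u` other than `v`. Deleting both ends of an edge `xy`, with `y ≠ u`, and joining the four
  loose ends in pairs gives a smaller cubic multigraph, bridgeless because all
  three-edge cuts are trivial. If the pairing respects the colours, then a matching of the smaller
  multigraph that contains `e`
  extends, with an odd class met (`exists_isPM_of_delete_edge`): it avoids the new edge at `u`, so
  it uses at most one of the two new edges.
* The colours prevent this for all choices only if the edges at `u`, `v` and all their neighbours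
  are uncoloured, while coloured cycles pass through all vertices at distance two from `e`. Then
  one colour `i` is given up in the smaller multigraph and met by force. If both other neighbours
  `p`, `q` of `x` lie on colour `i`, then `x` and `p` are deleted as before: one of `p`, `q` is
  not matched to `x`, hence is matched along colour `i` (`exists_isPM_of_common_colour`). If not,
  the path `x`, `p`, `m`, `n` is deleted, where `p`, `m`, `n` are consecutive on the cycle of
  colour `i`, and the six loose ends are paired in such a way that `n` is always matched along
  colour `i` (`ColouredPath.exists_isPM`).
-/

/-! ### Multigraphs -/

/-- A finite multigraph, given by finite sets of vertices and edges inside ambient types,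
together with the two ends of each edge. The orientation from `src` to `tgt` carries no meaning. -/
structure Multigraph (ν ε : Type*) where
  /-- the vertices -/
  verts : Finset ν
  /-- the edges -/
  edges : Finset ε
  /-- one end of an edge -/
  src : ε → ν
  /-- the other end of an edge -/
  tgt : ε → ν
  src_mem : ∀ f ∈ edges, src f ∈ verts
  tgt_mem : ∀ f ∈ edges, tgt f ∈ verts

namespace Multigraph

set_option linter.unusedSectionVars false

variable {ν ε κ : Type*} [DecidableEq ν] [DecidableEq ε] [DecidableEq κ]

/-- The number of ends of the edge `f` at the vertex `w`; a loop has two. -/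
def inc (G : Multigraph ν ε) (f : ε) (w : ν) : ℕ :=
  (if G.src f = w then 1 else 0) + (if G.tgt f = w then 1 else 0)

/-- The indicator of the edges that leave the vertex set `X`. -/
def cross (G : Multigraph ν ε) (X : Finset ν) (f : ε) : ℕ :=
  if (G.src f ∈ X ↔ G.tgt f ∈ X) then 0 else 1

/-- The edge `f` has the ends `a` and `b`. -/
def Joins (G : Multigraph ν ε) (f : ε) (a b : ν) : Prop :=
  (G.src f = a ∧ G.tgt f = b) ∨ (G.src f = b ∧ G.tgt f = a)

/-- Every vertex has degree three. -/
def Cubic (G : Multigraph ν ε) : Prop :=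
  ∀ w ∈ G.verts, ∑ f ∈ G.edges, G.inc f w = 3

/-- No edge cut consists of a single edge. -/
def Bridgeless (G : Multigraph ν ε) : Prop :=
  ∀ X ⊆ G.verts, ∑ f ∈ G.edges, G.cross X f ≠ 1

/-- A partial edge colouring in which every colour class has even degree at every vertex. In a
cubic multigraph this says that the colour classes are vertex-disjoint unions of cycles. -/
def EvenColouring (G : Multigraph ν ε) (col : ε → Option κ) : Prop :=
  ∀ w ∈ G.verts, ∀ c : κ, Even (∑ f ∈ G.edges with col f = some c, G.inc f w)

/-- A set of edges covering every vertex exactly once. -/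
def IsPM (G : Multigraph ν ε) (M : Finset ε) : Prop :=
  M ⊆ G.edges ∧ ∀ w ∈ G.verts, ∑ f ∈ M, G.inc f w = 1

/-- The edge set `M` meets every colour class with an odd number of edges. -/
def HitsOdd (G : Multigraph ν ε) (col : ε → Option κ) (M : Finset ε) : Prop :=
  ∀ c, Odd (G.edges.filter fun f => col f = some c).card → ∃ f ∈ M, col f = some c

/-- The edge cuts of size three are those around a single vertex. -/
def OnlyTrivialThreeCuts (G : Multigraph ν ε) : Prop :=
  ∀ X ⊆ G.verts, ∑ f ∈ G.edges, G.cross X f = 3 → X.card ≤ 1 ∨ (G.verts \ X).card ≤ 1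

variable {G : Multigraph ν ε} {f g h e : ε} {a b c w x y : ν} {X : Finset ν}
  {col : ε → Option κ} {M : Finset ε}

theorem Joins.symm (hf : G.Joins f a b) : G.Joins f b a := Or.symm hf

theorem joins_src_tgt (G : Multigraph ν ε) (f : ε) : G.Joins f (G.src f) (G.tgt f) :=
  Or.inl ⟨rfl, rfl⟩

theorem Joins.inc_eq (hf : G.Joins f a b) (w : ν) :
    G.inc f w = (if a = w then 1 else 0) + (if b = w then 1 else 0) := by
  rcases hf with ⟨rfl, rfl⟩ | ⟨rfl, rfl⟩
  · rfl
  · exact Nat.add_comm _ _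

theorem Joins.cross_eq (hf : G.Joins f a b) (X : Finset ν) :
    G.cross X f = if (a ∈ X ↔ b ∈ X) then 0 else 1 := by
  rcases hf with ⟨rfl, rfl⟩ | ⟨rfl, rfl⟩
  · rfl
  · simp only [cross, iff_comm]

theorem Joins.left_mem (hf : G.Joins f a b) (he : f ∈ G.edges) : a ∈ G.verts := by
  rcases hf with ⟨rfl, rfl⟩ | ⟨rfl, rfl⟩
  · exact G.src_mem _ he
  · exact G.tgt_mem _ he

theorem Joins.right_mem (hf : G.Joins f a b) (he : f ∈ G.edges) : b ∈ G.verts :=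
  hf.symm.left_mem he

theorem Joins.eq_or_eq (hf : G.Joins f a b) (hg : G.Joins f x y) : x = a ∨ x = b := by
  rcases hf with ⟨rfl, rfl⟩ | ⟨rfl, rfl⟩ <;> rcases hg with ⟨rfl, rfl⟩ | ⟨rfl, rfl⟩ <;> simp

theorem inc_ne_zero_iff : G.inc f w ≠ 0 ↔ ∃ b, G.Joins f w b := by
  constructor
  · intro h
    by_cases h1 : G.src f = w
    · exact ⟨_, Or.inl ⟨h1, rfl⟩⟩
    · by_cases h2 : G.tgt f = w
      · exact ⟨_, Or.inr ⟨rfl, h2⟩⟩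
      · simp [inc, h1, h2] at h
  · rintro ⟨b, hb⟩
    rw [hb.inc_eq]
    simp

/-- The handshake count for a vertex set `X` and an edge set `A`: edges of `A` inside `X` count
twice, and edges of `A` leaving `X` count once. -/
theorem sum_inc_eq (G : Multigraph ν ε) (X : Finset ν) (A : Finset ε) :
    ∑ w ∈ X, ∑ f ∈ A, G.inc f w =
      2 * (A.filter fun f => G.src f ∈ X ∧ G.tgt f ∈ X).card + ∑ f ∈ A, G.cross X f := by
  rw [Finset.sum_comm, Finset.card_filter, Finset.mul_sum, ← Finset.sum_add_distrib]
  refine Finset.sum_congr rfl fun f _ => ?_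
  simp only [inc, cross, Finset.sum_add_distrib, Finset.sum_ite_eq]
  by_cases h1 : G.src f ∈ X <;> by_cases h2 : G.tgt f ∈ X <;> simp [h1, h2]

theorem Cubic.three_mul_card (hG : G.Cubic) (hX : X ⊆ G.verts) :
    3 * X.card = 2 * (G.edges.filter fun f => G.src f ∈ X ∧ G.tgt f ∈ X).card +
      ∑ f ∈ G.edges, G.cross X f := by
  rw [← sum_inc_eq, Finset.sum_congr rfl fun w hw => hG w (hX hw)]
  simp [mul_comm]

/-- A colour class leaves every vertex set an even number of times. -/
theorem EvenColouring.even_cross (hc : G.EvenColouring col) (hX : X ⊆ G.verts) (c : κ) :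
    Even (∑ f ∈ G.edges with col f = some c, G.cross X f) := by
  have h := sum_inc_eq G X (G.edges.filter fun f => col f = some c)
  have h2 : Even (∑ w ∈ X, ∑ f ∈ G.edges with col f = some c, G.inc f w) :=
    Finset.even_sum _ fun w hw => hc w (hX hw) c
  rw [h] at h2
  exact (Nat.even_add.1 h2).1 (even_two_mul _)

/-- Two edges of a perfect matching do not share a vertex. -/
theorem IsPM.eq_of_joins (hM : G.IsPM M) (hf : f ∈ M) (hg : g ∈ M) (h1 : G.Joins f w a)
    (h2 : G.Joins g w b) : f = g := by
  by_contra hne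
  have hw : w ∈ G.verts := h1.left_mem (hM.1 hf)
  have hsub : ({f, g} : Finset ε) ⊆ M := by
    intro k hk
    simp only [Finset.mem_insert, Finset.mem_singleton] at hk
    rcases hk with rfl | rfl <;> assumption
  have h := Finset.sum_le_sum_of_subset (f := fun k => G.inc k w) hsub
  rw [hM.2 w hw, Finset.sum_pair hne, h1.inc_eq, h2.inc_eq] at h
  simp only [if_true] at h
  omega

theorem IsPM.exists_joins (hM : G.IsPM M) (hw : w ∈ G.verts) : ∃ f ∈ M, ∃ a, G.Joins f w a := by
  have h : ∑ f ∈ M, G.inc f w ≠ 0 := by rw [hM.2 w hw]; exact one_ne_zero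
  obtain ⟨f, hf, hne⟩ := Finset.exists_ne_zero_of_sum_ne_zero h
  exact ⟨f, hf, inc_ne_zero_iff.1 hne⟩

/-- A cubic bridgeless multigraph has no loops, for the third edge at a loop would be a bridge. -/
theorem Bridgeless.ne_of_joins (hB : G.Bridgeless) (hG : G.Cubic) (hf : f ∈ G.edges)
    (h : G.Joins f a b) : a ≠ b := by
  rintro rfl
  have ha := h.left_mem hf
  have h1 := hG.three_mul_card (Finset.singleton_subset_iff.2 ha)
  have h2 := hB {a} (Finset.singleton_subset_iff.2 ha)
  have h3 : 0 < (G.edges.filter fun f => G.src f ∈ ({a} : Finset ν) ∧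
      G.tgt f ∈ ({a} : Finset ν)).card := by
    refine Finset.card_pos.2 ⟨f, ?_⟩
    rcases h with ⟨h, h'⟩ | ⟨h, h'⟩ <;> simp [hf, h, h']
  simp only [Finset.card_singleton] at h1
  omega

/-- The edges `f`, `g`, `h` are distinct and are exactly the edges at the vertex `w`; their other
ends are `a`, `b`, `c`. -/
structure Star (G : Multigraph ν ε) (w : ν) (f g h : ε) (a b c : ν) : Prop where
  f_mem : f ∈ G.edges
  g_mem : g ∈ G.edges
  h_mem : h ∈ G.edges
  f_joins : G.Joins f w a
  g_joins : G.Joins g w b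
  h_joins : G.Joins h w c
  f_ne_g : f ≠ g
  f_ne_h : f ≠ h
  g_ne_h : g ≠ h
  eq_of_joins : ∀ k ∈ G.edges, ∀ d, G.Joins k w d → k = f ∨ k = g ∨ k = h

namespace Star

theorem swap (s : G.Star w f g h a b c) : G.Star w f h g a c b :=
  ⟨s.f_mem, s.h_mem, s.g_mem, s.f_joins, s.h_joins, s.g_joins, s.f_ne_h, s.f_ne_g, s.g_ne_h.symm,
    fun k hk d hd => by have := s.eq_of_joins k hk d hd; tauto⟩

end Star

/-- Every edge at a vertex extends to the star of that vertex. -/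
theorem exists_star (hB : G.Bridgeless) (hG : G.Cubic) (hf : f ∈ G.edges) (h : G.Joins f w a) :
    ∃ g h b c, G.Star w f g h a b c := by
  have hw := h.left_mem hf
  have hinc : ∀ k ∈ G.edges, G.inc k w = if G.inc k w ≠ 0 then 1 else 0 := by
    intro k hk
    split_ifs with h0
    · obtain ⟨b, hb⟩ := inc_ne_zero_iff.1 h0
      have := hB.ne_of_joins hG hk hb
      rw [hb.inc_eq]
      simp [this.symm]
    · exact not_not.1 h0
  have h3 := hG w hw
  rw [Finset.sum_congr rfl hinc, ← Finset.card_filter] at h3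
  set S := G.edges.filter fun k => G.inc k w ≠ 0 with hS
  have hfS : f ∈ S := Finset.mem_filter.2 ⟨hf, inc_ne_zero_iff.2 ⟨a, h⟩⟩
  have h2 : (S.erase f).card = 2 := by rw [Finset.card_erase_of_mem hfS, h3]
  obtain ⟨g, k, hgk, hS2⟩ := Finset.card_eq_two.1 h2
  have hg : g ∈ S.erase f := by rw [hS2]; simp
  have hk : k ∈ S.erase f := by rw [hS2]; simp
  simp only [Finset.mem_erase, hS, Finset.mem_filter] at hg hk
  obtain ⟨b, hb⟩ := inc_ne_zero_iff.1 hg.2.2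
  obtain ⟨c, hc⟩ := inc_ne_zero_iff.1 hk.2.2
  refine ⟨g, k, b, c, hf, hg.2.1, hk.2.1, h, hb, hc, hg.1.symm, hk.1.symm, hgk, ?_⟩
  intro m hm d hd
  by_cases hmf : m = f
  · exact Or.inl hmf
  · have : m ∈ S.erase f :=
      Finset.mem_erase.2 ⟨hmf, Finset.mem_filter.2 ⟨hm, inc_ne_zero_iff.2 ⟨d, hd⟩⟩⟩
    rw [hS2] at this
    simpa [hmf] using this

/-- Three colours, each of which occurs an even number of times: two of them agree and the third
is absent. -/
theorem even_triple {p q r : Option κ} (hev : ∀ c, Even ((if p = some c then 1 else 0) +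
    (if q = some c then 1 else 0) + (if r = some c then 1 else 0))) :
    (p = q ∧ r = none) ∨ (q = r ∧ p = none) ∨ (p = r ∧ q = none) := by
  rcases p with _ | p <;> rcases q with _ | q <;> rcases r with _ | r
  · simp
  · have := hev r; simp at this
  · have := hev q; simp at this
  · have := hev q
    by_cases hqr : r = q <;> simp_all
  · have := hev p; simp at this
  · have := hev p
    by_cases hqr : r = p <;> simp_all
  · have := hev p
    by_cases hqr : q = p <;> simp_all
  · have h1 := hev p
    have h2 := hev q
    have h3 := hev r
    have no : ¬ Even 3 := by decide
    by_cases hpq : p = q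
    · subst hpq
      by_cases hpr : p = r
      · subst hpr
        simp [no] at h1
      · simp [hpr] at h3
    · by_cases hpr : p = r
      · subst hpr
        simp [hpq] at h2
      · simp [Ne.symm hpq, Ne.symm hpr] at h1

theorem Star.sum_eq (s : G.Star w f g h a b c) (hB : G.Bridgeless) (hG : G.Cubic)
    (φ : ε → ℕ) (A : Finset ε) (hA : A ⊆ G.edges) :
    ∑ k ∈ A, G.inc k w * φ k =
      (if f ∈ A then φ f else 0) + (if g ∈ A then φ g else 0) + (if h ∈ A then φ h else 0) := by
  have h1 : ∀ k ∈ A, G.inc k w * φ k = (if f = k then φ k else 0) + (if g = k then φ k else 0) +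
      (if h = k then φ k else 0) := by
    intro k hk
    by_cases h0 : G.inc k w = 0
    · have hn : ∀ d, ¬ G.Joins k w d := fun d hd => inc_ne_zero_iff.2 ⟨d, hd⟩ h0
      have n1 : f ≠ k := by rintro rfl; exact hn _ s.f_joins
      have n2 : g ≠ k := by rintro rfl; exact hn _ s.g_joins
      have n3 : h ≠ k := by rintro rfl; exact hn _ s.h_joins
      simp [h0, n1, n2, n3]
    · obtain ⟨d, hd⟩ := inc_ne_zero_iff.1 h0
      have hne := hB.ne_of_joins hG (hA hk) hd
      rw [hd.inc_eq]
      rcases s.eq_of_joins k (hA hk) d hd with rfl | rfl | rfl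
      · simp [hne.symm, s.f_ne_g.symm, s.f_ne_h.symm]
      · simp [hne.symm, s.f_ne_g, s.g_ne_h.symm]
      · simp [hne.symm, s.f_ne_h, s.g_ne_h]
  rw [Finset.sum_congr rfl h1, Finset.sum_add_distrib, Finset.sum_add_distrib]
  simp

/-- At a vertex of a cubic multigraph, an even colouring gives two edges the same colour and the
third edge no colour. -/
theorem EvenColouring.star (hc : G.EvenColouring col) (hB : G.Bridgeless) (hG : G.Cubic)
    (s : G.Star w f g h a b c) :
    (col f = col g ∧ col h = none) ∨ (col g = col h ∧ col f = none) ∨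
      (col f = col h ∧ col g = none) := by
  refine even_triple fun i => ?_
  have h1 := hc w (s.f_joins.left_mem s.f_mem) i
  have h2 := s.sum_eq hB hG (fun k => if col k = some i then 1 else 0) G.edges subset_rfl
  simp only [s.f_mem, s.g_mem, s.h_mem, if_true, mul_ite, mul_one, mul_zero] at h2
  rwa [Finset.sum_filter, h2] at h1

/-! ### Deleting vertices and joining the loose ends -/

/-- The data of a local reduction, which deletes a vertex set `P` and joins up the edges leaving `P`
in pairs. The edges of `G` are those in `R`, which avoid `P`, those in `I`, which lie inside `P`,
and the edges `p j` and `q j` that lead from `P` to `α j` and `β j` respectively. -/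
structure Surgery {ι : Type*} [Fintype ι] (G : Multigraph ν ε) (P : Finset ν) (R I : Finset ε)
    (p q : ι → ε) (α β : ι → ν) : Prop where
  subset : P ⊆ G.verts
  two_le : 2 ≤ P.card
  rest_subset : R ⊆ G.edges
  rest_src : ∀ f ∈ R, G.src f ∉ P
  rest_tgt : ∀ f ∈ R, G.tgt f ∉ P
  injective : Function.Injective p
  notMem_rest : ∀ j, p j ∉ R
  left_mem : ∀ j, α j ∈ G.verts
  left_notMem : ∀ j, α j ∉ P
  right_mem : ∀ j, β j ∈ G.verts
  right_notMem : ∀ j, β j ∉ P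
  ne : ∀ j, α j ≠ β j
  left_joins : ∀ j, ∃ x ∈ P, G.Joins (p j) (α j) x
  right_joins : ∀ j, ∃ x ∈ P, G.Joins (q j) (β j) x
  inner_src : ∀ f ∈ I, G.src f ∈ P
  inner_tgt : ∀ f ∈ I, G.tgt f ∈ P
  sum_eq : ∀ φ : ε → ℕ, ∑ f ∈ G.edges, φ f =
    ∑ f ∈ R, φ f + ∑ j, φ (p j) + ∑ j, φ (q j) + ∑ f ∈ I, φ f

namespace Surgery

variable {ι : Type*} [Fintype ι] {P : Finset ν} {R I : Finset ε} {p q : ι → ε} {α β : ι → ν}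

/-- The multigraph obtained by deleting `P` and joining `α j` to `β j` by an edge, for which the
name `p j` is used again. -/
noncomputable def graph (s : G.Surgery P R I p q α β) : Multigraph ν ε where
  verts := G.verts \ P
  edges := R ∪ Finset.univ.image p
  src := Function.extend p α G.src
  tgt := Function.extend p β G.tgt
  src_mem := by
    intro f hf
    by_cases h : ∃ j, p j = f
    · obtain ⟨j, rfl⟩ := h
      rw [s.injective.extend_apply]
      exact Finset.mem_sdiff.2 ⟨s.left_mem j, s.left_notMem j⟩
    · rw [Function.extend_apply' _ _ _ h]
      have hR : f ∈ R := by
        rcases Finset.mem_union.1 hf with h1 | h1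
        · exact h1
        · obtain ⟨j, -, hj⟩ := Finset.mem_image.1 h1
          exact absurd ⟨j, hj⟩ h
      exact Finset.mem_sdiff.2 ⟨G.src_mem _ (s.rest_subset hR), s.rest_src f hR⟩
  tgt_mem := by
    intro f hf
    by_cases h : ∃ j, p j = f
    · obtain ⟨j, rfl⟩ := h
      rw [s.injective.extend_apply]
      exact Finset.mem_sdiff.2 ⟨s.right_mem j, s.right_notMem j⟩
    · rw [Function.extend_apply' _ _ _ h]
      have hR : f ∈ R := by
        rcases Finset.mem_union.1 hf with h1 | h1
        · exact h1
        · obtain ⟨j, -, hj⟩ := Finset.mem_image.1 h1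
          exact absurd ⟨j, hj⟩ h
      exact Finset.mem_sdiff.2 ⟨G.tgt_mem _ (s.rest_subset hR), s.rest_tgt f hR⟩

theorem joins_new (s : G.Surgery P R I p q α β) (j : ι) : s.graph.Joins (p j) (α j) (β j) :=
  Or.inl ⟨s.injective.extend_apply _ _ _, s.injective.extend_apply _ _ _⟩

theorem joins_rest (s : G.Surgery P R I p q α β) (hf : f ∈ R) :
    s.graph.Joins f (G.src f) (G.tgt f) := by
  have h : ¬ ∃ j, p j = f := by
    rintro ⟨j, rfl⟩
    exact s.notMem_rest j hf
  exact Or.inl ⟨Function.extend_apply' _ _ _ h, Function.extend_apply' _ _ _ h⟩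

theorem inc_rest (s : G.Surgery P R I p q α β) (hf : f ∈ R) (w : ν) :
    s.graph.inc f w = G.inc f w := by
  rw [(s.joins_rest hf).inc_eq, (G.joins_src_tgt f).inc_eq]

theorem sum_graph_eq (s : G.Surgery P R I p q α β) (φ : ε → ℕ) :
    ∑ f ∈ s.graph.edges, φ f = ∑ f ∈ R, φ f + ∑ j, φ (p j) := by
  have hd : Disjoint R (Finset.univ.image p) := by
    rw [Finset.disjoint_right]
    intro f hf
    obtain ⟨j, -, rfl⟩ := Finset.mem_image.1 hf
    exact s.notMem_rest j
  change ∑ f ∈ R ∪ Finset.univ.image p, φ f = _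
  rw [Finset.sum_union hd, Finset.sum_image fun i _ j _ hij => s.injective hij]

theorem cross_rest (s : G.Surgery P R I p q α β) (hf : f ∈ R) (X : Finset ν) :
    s.graph.cross X f = G.cross X f := by
  rw [(s.joins_rest hf).cross_eq, (G.joins_src_tgt f).cross_eq]

/-- Degrees outside `P` do not change, and neither do the degrees in a set of edges that contains
both or neither of `p j` and `q j`. -/
theorem sum_inc (s : G.Surgery P R I p q α β) (φ : ε → ℕ) (hφ : ∀ j, φ (p j) = φ (q j))
    (hw : w ∉ P) :
    ∑ f ∈ s.graph.edges, s.graph.inc f w * φ f = ∑ f ∈ G.edges, G.inc f w * φ f := by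
  rw [s.sum_graph_eq, s.sum_eq, Finset.sum_congr rfl fun f hf => by rw [s.inc_rest hf]]
  have hI : ∑ f ∈ I, G.inc f w * φ f = 0 := by
    refine Finset.sum_eq_zero fun f hf => ?_
    have h1 : G.src f ≠ w := fun h => hw (h ▸ s.inner_src f hf)
    have h2 : G.tgt f ≠ w := fun h => hw (h ▸ s.inner_tgt f hf)
    simp [inc, h1, h2]
  have hj : ∀ j, s.graph.inc (p j) w * φ (p j) =
      G.inc (p j) w * φ (p j) + G.inc (q j) w * φ (q j) := by
    intro j
    obtain ⟨x, hx, hjx⟩ := s.left_joins j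
    obtain ⟨y, hy, hjy⟩ := s.right_joins j
    have h1 : x ≠ w := fun h => hw (h ▸ hx)
    have h2 : y ≠ w := fun h => hw (h ▸ hy)
    rw [(s.joins_new j).inc_eq, hjx.inc_eq, hjy.inc_eq, ← hφ j]
    simp [h1, h2, add_mul]
  rw [hI, add_zero, Finset.sum_congr rfl fun j _ => hj j, Finset.sum_add_distrib, add_assoc]

theorem cubic (s : G.Surgery P R I p q α β) (hG : G.Cubic) : s.graph.Cubic := by
  intro w hw
  obtain ⟨hw1, hw2⟩ := Finset.mem_sdiff.1 hw
  have := s.sum_inc (fun _ => 1) (fun _ => rfl) hw2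
  simpa [hG w hw1] using this

theorem evenColouring (s : G.Surgery P R I p q α β) (hc : G.EvenColouring col)
    (hcol : ∀ j, col (p j) = col (q j)) : s.graph.EvenColouring col := by
  intro w hw c
  obtain ⟨hw1, hw2⟩ := Finset.mem_sdiff.1 hw
  have h := s.sum_inc (fun f => if col f = some c then 1 else 0) (fun j => by rw [hcol j]) hw2
  have h2 := hc w hw1 c
  simp only [mul_ite, mul_one, mul_zero] at h
  rwa [Finset.sum_filter, h, ← Finset.sum_filter]

theorem cross_eq (s : G.Surgery P R I p q α β) (hX : Disjoint X P) :
    ∑ f ∈ G.edges, G.cross X f = ∑ f ∈ R, G.cross X f +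
      ∑ j, ((if α j ∈ X then 1 else 0) + (if β j ∈ X then 1 else 0)) := by
  have hP : ∀ {v}, v ∈ P → v ∉ X := fun hv hv' => Finset.disjoint_left.1 hX hv' hv
  rw [s.sum_eq, Finset.sum_add_distrib, ← add_assoc]
  have hI : ∑ f ∈ I, G.cross X f = 0 := by
    refine Finset.sum_eq_zero fun f hf => ?_
    simp [cross, hP (s.inner_src f hf), hP (s.inner_tgt f hf)]
  rw [hI, add_zero]
  congr 1
  · congr 1
    refine Finset.sum_congr rfl fun j _ => ?_
    obtain ⟨x, hx, hjx⟩ := s.left_joins j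
    by_cases h : α j ∈ X <;> simp [hjx.cross_eq, hP hx, h]
  · refine Finset.sum_congr rfl fun j _ => ?_
    obtain ⟨x, hx, hjx⟩ := s.right_joins j
    by_cases h : β j ∈ X <;> simp [hjx.cross_eq, hP hx, h]

theorem cross_union_eq (s : G.Surgery P R I p q α β) (X : Finset ν) :
    ∑ f ∈ G.edges, G.cross (X ∪ P) f = ∑ f ∈ R, G.cross X f +
      ∑ j, ((if α j ∈ X then 0 else 1) + (if β j ∈ X then 0 else 1)) := by
  rw [s.sum_eq, Finset.sum_add_distrib, ← add_assoc]
  have hI : ∑ f ∈ I, G.cross (X ∪ P) f = 0 := by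
    refine Finset.sum_eq_zero fun f hf => ?_
    simp [cross, s.inner_src f hf, s.inner_tgt f hf]
  rw [hI, add_zero]
  congr 1
  · congr 1
    · refine Finset.sum_congr rfl fun f hf => ?_
      simp [cross, s.rest_src f hf, s.rest_tgt f hf]
    refine Finset.sum_congr rfl fun j _ => ?_
    obtain ⟨x, hx, hjx⟩ := s.left_joins j
    by_cases h : α j ∈ X <;> simp [hjx.cross_eq, hx, h, s.left_notMem j]
  · refine Finset.sum_congr rfl fun j _ => ?_
    obtain ⟨x, hx, hjx⟩ := s.right_joins j
    by_cases h : β j ∈ X <;> simp [hjx.cross_eq, hx, h, s.right_notMem j]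

/-- Joining up at most three pairs of edges creates no bridge, provided that every three-edge cut
is trivial: a bridge would come from a cut with one or three edges, and in the latter case
each side would contain both ends of a new edge or the whole of `P`. -/
theorem bridgeless (s : G.Surgery P R I p q α β) (hι : Fintype.card ι ≤ 3) (hB : G.Bridgeless)
    (hT : G.OnlyTrivialThreeCuts) : s.graph.Bridgeless := by
  intro X hX h1
  have hXV : X ⊆ G.verts := fun v hv => (Finset.mem_sdiff.1 (hX hv)).1
  have hXP : Disjoint X P :=
    Finset.disjoint_left.2 fun v hv => (Finset.mem_sdiff.1 (hX hv)).2
  have hYV : X ∪ P ⊆ G.verts := Finset.union_subset hXV s.subset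
  rw [s.sum_graph_eq, Finset.sum_congr rfl fun f hf => s.cross_rest hf X,
    Finset.sum_congr rfl fun j _ => (s.joins_new j).cross_eq X] at h1
  have hX1 := hB X hXV
  have hY1 := hB _ hYV
  have hX3 := hT X hXV
  have hY3 := hT _ hYV
  rw [s.cross_eq hXP] at hX1 hX3
  rw [s.cross_union_eq] at hY1 hY3
  -- `m₁`, `m₂`, `m₃` count the new edges inside `X`, leaving `X`, and outside `X`
  set r := ∑ f ∈ R, G.cross X f
  set m₁ := (Finset.univ.filter fun j => α j ∈ X ∧ β j ∈ X).card with hm1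
  set m₂ := (Finset.univ.filter fun j => ¬ (α j ∈ X ↔ β j ∈ X)).card with hm2
  set m₃ := (Finset.univ.filter fun j => α j ∉ X ∧ β j ∉ X).card with hm3
  have e1 : (∑ j, if (α j ∈ X ↔ β j ∈ X) then 0 else 1) = m₂ := by
    rw [hm2, Finset.card_filter]
    exact Finset.sum_congr rfl fun j _ => by split_ifs <;> simp_all
  have e2 : ∑ j, ((if α j ∈ X then 1 else 0) + (if β j ∈ X then 1 else 0)) = 2 * m₁ + m₂ := by
    rw [hm1, hm2, Finset.card_filter, Finset.card_filter, Finset.mul_sum,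
      ← Finset.sum_add_distrib]
    exact Finset.sum_congr rfl fun j _ => by
      by_cases ha : α j ∈ X <;> by_cases hb : β j ∈ X <;> simp [ha, hb]
  have e3 : ∑ j, ((if α j ∈ X then 0 else 1) + (if β j ∈ X then 0 else 1)) = 2 * m₃ + m₂ := by
    rw [hm3, hm2, Finset.card_filter, Finset.card_filter, Finset.mul_sum,
      ← Finset.sum_add_distrib]
    exact Finset.sum_congr rfl fun j _ => by
      by_cases ha : α j ∈ X <;> by_cases hb : β j ∈ X <;> simp [ha, hb]
  have e4 : m₁ + m₂ + m₃ = Fintype.card ι := by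
    rw [hm1, hm2, hm3, Finset.card_filter, Finset.card_filter, Finset.card_filter,
      ← Finset.sum_add_distrib, ← Finset.sum_add_distrib, ← Finset.card_univ,
      Finset.card_eq_sum_ones]
    exact Finset.sum_congr rfl fun j _ => by
      by_cases ha : α j ∈ X <;> by_cases hb : β j ∈ X <;> simp [ha, hb]
  rw [e1] at h1
  rw [e2] at hX1 hX3
  rw [e3] at hY1 hY3
  have hP1 : 1 < P.card := s.two_le
  have hcX : 0 < m₁ → 1 < X.card := by
    intro h
    obtain ⟨j, hj⟩ := Finset.card_pos.1 h
    obtain ⟨-, ha, hb⟩ := Finset.mem_filter.1 hj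
    exact Finset.one_lt_card.2 ⟨_, ha, _, hb, s.ne j⟩
  have hcX' : 1 < (G.verts \ X).card :=
    hP1.trans_le (Finset.card_le_card fun v hv => Finset.mem_sdiff.2
      ⟨s.subset hv, fun hv' => Finset.disjoint_left.1 hXP hv' hv⟩)
  have hcY : 1 < (X ∪ P).card :=
    hP1.trans_le (Finset.card_le_card Finset.subset_union_right)
  have hcY' : 0 < m₃ → 1 < (G.verts \ (X ∪ P)).card := by
    intro h
    obtain ⟨j, hj⟩ := Finset.card_pos.1 h
    obtain ⟨-, ha, hb⟩ := Finset.mem_filter.1 hj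
    refine Finset.one_lt_card.2 ⟨α j, ?_, β j, ?_, s.ne j⟩
    · simp [s.left_mem j, s.left_notMem j, ha]
    · simp [s.right_mem j, s.right_notMem j, hb]
  rcases Nat.lt_or_ge m₁ 2 with hm | hm
  · interval_cases m₁
    · omega
    · have := hX3 (by omega)
      have := hcX (by omega)
      omega
  · have : m₃ < 2 := by omega
    interval_cases m₃
    · omega
    · have := hY3 (by omega)
      have := hcY' (by omega)
      omega

theorem card_lt (s : G.Surgery P R I p q α β) : s.graph.verts.card < G.verts.card := by
  have h := Finset.card_sdiff_add_card_eq_card s.subset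
  have := s.two_le
  change (G.verts \ P).card < _
  omega

/-- The parity of a colour class does not change if an even number of its edges is deleted. -/
theorem odd_card (s : G.Surgery P R I p q α β) {i : κ}
    (hev : Even ((∑ j, if col (q j) = some i then 1 else 0) +
      ∑ f ∈ I, if col f = some i then 1 else 0))
    (hodd : Odd (G.edges.filter fun f => col f = some i).card) :
    Odd (s.graph.edges.filter fun f => col f = some i).card := by
  rw [Finset.card_filter] at hodd ⊢
  rw [s.sum_graph_eq]
  rw [s.sum_eq, add_assoc] at hodd
  exact (Nat.odd_add.1 hodd).2 hev

end Surgery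

/-! ### Deletion of an edge -/

variable (κ) in
/-- For every edge `e` and every even colouring with colours in `κ`, some perfect matching
contains `e` and meets every colour class of odd size. -/
def OddQuelling (G : Multigraph ν ε) : Prop :=
  ∀ e ∈ G.edges, ∀ col : ε → Option κ, G.EvenColouring col →
    ∃ M, G.IsPM M ∧ e ∈ M ∧ G.HitsOdd col M

/-- Cubic bridgeless multigraphs in which every three-edge cut is trivial, with enough vertices to
be simple and triangle-free. -/
structure Irreducible (G : Multigraph ν ε) : Prop where
  cubic : G.Cubic
  bridgeless : G.Bridgeless
  trivial_cuts : G.OnlyTrivialThreeCuts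
  five_le : 5 ≤ G.verts.card

namespace Irreducible

theorem false_of_three (hI : G.Irreducible) (hab : a ≠ b) (hac : a ≠ c) (hbc : b ≠ c)
    (ha : a ∈ G.verts) (hb : b ∈ G.verts) (hc : c ∈ G.verts)
    (hf : f ∈ G.edges) (hg : g ∈ G.edges) (hh : h ∈ G.edges)
    (hfg : f ≠ g) (hfh : f ≠ h) (hgh : g ≠ h)
    (hin : ∀ k ∈ ({f, g, h} : Finset ε),
      G.src k ∈ ({a, b, c} : Finset ν) ∧ G.tgt k ∈ ({a, b, c} : Finset ν)) : False := by
  have hX : ({a, b, c} : Finset ν) ⊆ G.verts := by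
    intro v hv
    simp only [Finset.mem_insert, Finset.mem_singleton] at hv
    rcases hv with rfl | rfl | rfl <;> assumption
  have hcard : ({a, b, c} : Finset ν).card = 3 := by
    rw [Finset.card_eq_three]
    exact ⟨a, b, c, hab, hac, hbc, rfl⟩
  have h3 : ({f, g, h} : Finset ε).card = 3 := by
    rw [Finset.card_eq_three]
    exact ⟨f, g, h, hfg, hfh, hgh, rfl⟩
  have hsub : ({f, g, h} : Finset ε) ⊆ G.edges.filter fun k =>
      G.src k ∈ ({a, b, c} : Finset ν) ∧ G.tgt k ∈ ({a, b, c} : Finset ν) := by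
    intro k hk
    refine Finset.mem_filter.2 ⟨?_, hin k hk⟩
    simp only [Finset.mem_insert, Finset.mem_singleton] at hk
    rcases hk with rfl | rfl | rfl <;> assumption
  have h1 := Finset.card_le_card hsub
  have h2 := hI.cubic.three_mul_card hX
  have h4 := hI.bridgeless _ hX
  have h5 := hI.trivial_cuts _ hX
  have h6 := Finset.card_sdiff_add_card_eq_card hX
  have h7 := hI.five_le
  omega

theorem ne_of_joins (hI : G.Irreducible) (hf : f ∈ G.edges) (h : G.Joins f a b) : a ≠ b :=
  hI.bridgeless.ne_of_joins hI.cubic hf h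

theorem eq_of_joins (hI : G.Irreducible) (hf : f ∈ G.edges) (hg : g ∈ G.edges)
    (h1 : G.Joins f a b) (h2 : G.Joins g a b) : f = g := by
  by_contra hfg
  obtain ⟨g', h', b', c, s⟩ := exists_star hI.bridgeless hI.cubic hf h1
  obtain ⟨k, d, hk, hkj, hfk, hgk⟩ :
      ∃ k d, k ∈ G.edges ∧ G.Joins k a d ∧ f ≠ k ∧ g ≠ k := by
    rcases s.eq_of_joins g hg b h2 with rfl | rfl | rfl
    · exact absurd rfl hfg
    · exact ⟨h', c, s.h_mem, s.h_joins, s.f_ne_h, s.g_ne_h⟩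
    · exact ⟨g', b', s.g_mem, s.g_joins, s.f_ne_g, s.g_ne_h.symm⟩
  have hab := hI.ne_of_joins hf h1
  have had := hI.ne_of_joins hk hkj
  have ha := h1.left_mem hf
  have hb := h1.right_mem hf
  have key : ∀ z, z ∈ G.verts → a ≠ z → b ≠ z → (d = b ∨ d = z) → False := by
    intro z hz haz hbz hd
    refine hI.false_of_three hab haz hbz ha hb hz hf hg hk hfg hfk hgk ?_
    intro m hm
    simp only [Finset.mem_insert, Finset.mem_singleton] at hm ⊢
    rcases hm with rfl | rfl | rfl
    · rcases h1 with ⟨h, h'⟩ | ⟨h, h'⟩ <;> simp [h, h']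
    · rcases h2 with ⟨h, h'⟩ | ⟨h, h'⟩ <;> simp [h, h']
    · rcases hkj with ⟨h, h'⟩ | ⟨h, h'⟩ <;> rcases hd with hd | hd <;> simp [h, h', hd]
  by_cases hdb : d = b
  · have hlt : ({a, b} : Finset ν).card < G.verts.card :=
      lt_of_le_of_lt Finset.card_le_two (by have := hI.five_le; omega)
    obtain ⟨z, hz, hz'⟩ := Finset.exists_mem_notMem_of_card_lt_card hlt
    simp only [Finset.mem_insert, Finset.mem_singleton, not_or] at hz'
    exact key z hz (Ne.symm hz'.1) (Ne.symm hz'.2) (Or.inl hdb)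
  · exact key d (hkj.right_mem hk) had (Ne.symm hdb) (Or.inr rfl)

theorem no_triangle (hI : G.Irreducible) (hf : f ∈ G.edges) (hg : g ∈ G.edges)
    (hh : h ∈ G.edges) (h1 : G.Joins f a b) (h2 : G.Joins g b c) (h3 : G.Joins h a c) :
    False := by
  have hab := hI.ne_of_joins hf h1
  have hbc := hI.ne_of_joins hg h2
  have hac := hI.ne_of_joins hh h3
  refine hI.false_of_three hab hac hbc (h1.left_mem hf) (h1.right_mem hf) (h3.right_mem hh)
    hf hg hh ?_ ?_ ?_ ?_
  · rintro rfl
    rcases h1.eq_or_eq h2.symm with h | h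
    · exact hac h.symm
    · exact hbc h.symm
  · rintro rfl
    rcases h1.eq_or_eq h3.symm with h | h
    · exact hac h.symm
    · exact hbc h.symm
  · rintro rfl
    rcases h2.eq_or_eq h3 with h | h
    · exact hab h
    · exact hac h
  · intro m hm
    simp only [Finset.mem_insert, Finset.mem_singleton] at hm ⊢
    rcases hm with rfl | rfl | rfl
    · rcases h1 with ⟨h, h'⟩ | ⟨h, h'⟩ <;> simp [h, h']
    · rcases h2 with ⟨h, h'⟩ | ⟨h, h'⟩ <;> simp [h, h']
    · rcases h3 with ⟨h, h'⟩ | ⟨h, h'⟩ <;> simp [h, h']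

end Irreducible

namespace Surgery

variable {ι : Type*} [Fintype ι] {P : Finset ν} {R I : Finset ε} {p q : ι → ε} {α β : ι → ν}

theorem joins_rest_of_joins (s : G.Surgery P R I p q α β) (hf : f ∈ R) (hj : G.Joins f a b) :
    s.graph.Joins f a b := by
  have := s.joins_rest hf
  rcases hj with ⟨rfl, rfl⟩ | ⟨rfl, rfl⟩
  · exact this
  · exact this.symm

/-- A perfect matching of the reduced multigraph, with its new edges replaced by a set `T` of edges
at `P`, is a perfect matching if `T` covers `P` once and covers the same vertices outside `P` as
the new edges did. -/
theorem isPM_extend (s : G.Surgery P R I p q α β) (hM : s.graph.IsPM M) {T : Finset ε}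
    (hT : T ⊆ G.edges) (hTR : Disjoint R T)
    (hout : ∀ w ∉ P, ∑ f ∈ T, G.inc f w =
      ∑ j, if p j ∈ M then (if α j = w then 1 else 0) + (if β j = w then 1 else 0) else 0)
    (hin : ∀ w ∈ P, ∑ f ∈ T, G.inc f w = 1) :
    G.IsPM (M.filter (· ∈ R) ∪ T) := by
  have hd : Disjoint (M.filter (· ∈ R)) T :=
    Finset.disjoint_left.2 fun f hf => Finset.disjoint_left.1 hTR (Finset.mem_filter.1 hf).2
  refine ⟨?_, fun w hw => ?_⟩
  · intro f hf
    rcases Finset.mem_union.1 hf with h | h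
    · exact s.rest_subset (Finset.mem_filter.1 h).2
    · exact hT h
  rw [Finset.sum_union hd]
  by_cases hwP : w ∈ P
  · rw [hin w hwP, Finset.sum_eq_zero, zero_add]
    intro f hf
    have hfR := (Finset.mem_filter.1 hf).2
    have h1 : G.src f ≠ w := fun h => s.rest_src f hfR (h ▸ hwP)
    have h2 : G.tgt f ≠ w := fun h => s.rest_tgt f hfR (h ▸ hwP)
    simp [inc, h1, h2]
  · refine Eq.trans ?_ (hM.2 w (Finset.mem_sdiff.2 ⟨hw, hwP⟩))
    rw [hout w hwP]
    have h1 := s.sum_graph_eq fun f => if f ∈ M then s.graph.inc f w else 0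
    rw [← Finset.sum_filter, Finset.filter_mem_eq_inter, Finset.inter_eq_right.2 hM.1] at h1
    rw [h1]
    congr 1
    · rw [Finset.sum_filter, Finset.sum_ite_mem, ← Finset.sum_filter,
        Finset.filter_mem_eq_inter, Finset.inter_comm]
      exact Finset.sum_congr rfl fun f hf => (s.inc_rest (Finset.mem_inter.1 hf).1 w).symm
    · refine Finset.sum_congr rfl fun j _ => ?_
      rw [(s.joins_new j).inc_eq]

end Surgery

/-- The edges avoiding the vertices `x` and `y` and the edges at them, in the situation of
`exists_isPM_of_delete_edge`. -/
theorem surgery_edge {u x y x' y₁ y₂ : ν} {f₁ f₂ f₃ f₄ f₅ : ε} (hI : G.Irreducible)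
    (sx : G.Star x f₁ f₂ f₃ u x' y) (sy : G.Star y f₃ f₄ f₅ x y₁ y₂) :
    G.Surgery {x, y} (G.edges \ {f₁, f₂, f₃, f₄, f₅}) {f₃} ![f₁, f₂] ![f₄, f₅] ![u, x']
      ![y₁, y₂] := by
  have hxy := hI.ne_of_joins sx.h_mem sx.h_joins
  have hxu := hI.ne_of_joins sx.f_mem sx.f_joins
  have hxx := hI.ne_of_joins sx.g_mem sx.g_joins
  have hy1 := hI.ne_of_joins sy.g_mem sy.g_joins
  have hy2 := hI.ne_of_joins sy.h_mem sy.h_joins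
  have hxy1 : x ≠ y₁ := fun h =>
    sy.f_ne_g (hI.eq_of_joins sy.f_mem sy.g_mem sy.f_joins (h ▸ sy.g_joins))
  have hxy2 : x ≠ y₂ := fun h =>
    sy.f_ne_h (hI.eq_of_joins sy.f_mem sy.h_mem sy.f_joins (h ▸ sy.h_joins))
  have hyu : y ≠ u := fun h =>
    sx.f_ne_h (hI.eq_of_joins sx.f_mem sx.h_mem sx.f_joins (h ▸ sx.h_joins))
  have hyx : y ≠ x' := fun h =>
    sx.g_ne_h (hI.eq_of_joins sx.g_mem sx.h_mem sx.g_joins (h ▸ sx.h_joins))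
  have key : ∀ k l : ε, ∀ a b : ν, G.Joins k x a → G.Joins l y b → x ≠ b → k ≠ l := by
    rintro k _ a b h1 h2 h3 rfl
    rcases h2.eq_or_eq h1 with h | h
    · exact hxy h
    · exact h3 h
  have n14 := key _ _ _ _ sx.f_joins sy.g_joins hxy1
  have n15 := key _ _ _ _ sx.f_joins sy.h_joins hxy2
  have n24 := key _ _ _ _ sx.g_joins sy.g_joins hxy1
  have n25 := key _ _ _ _ sx.g_joins sy.h_joins hxy2
  have hS : ({f₁, f₂, f₃, f₄, f₅} : Finset ε) ⊆ G.edges := by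
    intro k hk
    simp only [Finset.mem_insert, Finset.mem_singleton] at hk
    rcases hk with rfl | rfl | rfl | rfl | rfl
    exacts [sx.f_mem, sx.g_mem, sx.h_mem, sy.g_mem, sy.h_mem]
  have hR : ∀ k ∈ G.edges \ {f₁, f₂, f₃, f₄, f₅}, ∀ w ∈ ({x, y} : Finset ν), ∀ d,
      ¬ G.Joins k w d := by
    intro k hk w hw d hd
    simp only [Finset.mem_sdiff, Finset.mem_insert, Finset.mem_singleton, not_or] at hk hw
    rcases hw with rfl | rfl
    · have := sx.eq_of_joins k hk.1 d hd
      tauto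
    · have := sy.eq_of_joins k hk.1 d hd
      tauto
  exact {
    subset := by
      intro v hv
      simp only [Finset.mem_insert, Finset.mem_singleton] at hv
      rcases hv with rfl | rfl
      exacts [sx.f_joins.left_mem sx.f_mem, sy.f_joins.left_mem sy.f_mem]
    two_le := (Finset.card_pair hxy).ge
    rest_subset := Finset.sdiff_subset
    rest_src := fun k hk hP => hR k hk _ hP _ (G.joins_src_tgt k)
    rest_tgt := fun k hk hP => hR k hk _ hP _ (G.joins_src_tgt k).symm
    injective := by
      intro i j hij
      fin_cases i <;> fin_cases j <;> simp_all [sx.f_ne_g, sx.f_ne_g.symm]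
    notMem_rest := by
      intro j
      fin_cases j <;> simp
    left_mem := by
      intro j
      fin_cases j
      exacts [sx.f_joins.right_mem sx.f_mem, sx.g_joins.right_mem sx.g_mem]
    left_notMem := by
      intro j
      fin_cases j <;> simp [hxu.symm, hyu.symm, hxx.symm, hyx.symm]
    right_mem := by
      intro j
      fin_cases j
      exacts [sy.g_joins.right_mem sy.g_mem, sy.h_joins.right_mem sy.h_mem]
    right_notMem := by
      intro j
      fin_cases j <;> simp [hxy1.symm, hxy2.symm, hy1.symm, hy2.symm]
    ne := by
      intro j
      fin_cases j
      · rintro (h : u = y₁)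
        exact hI.no_triangle sx.h_mem sy.g_mem sx.f_mem sx.h_joins sy.g_joins (h ▸ sx.f_joins)
      · rintro (h : x' = y₂)
        exact hI.no_triangle sx.h_mem sy.h_mem sx.g_mem sx.h_joins sy.h_joins (h ▸ sx.g_joins)
    left_joins := by
      intro j
      fin_cases j
      exacts [⟨x, by simp, sx.f_joins.symm⟩, ⟨x, by simp, sx.g_joins.symm⟩]
    right_joins := by
      intro j
      fin_cases j
      exacts [⟨y, by simp, sy.g_joins.symm⟩, ⟨y, by simp, sy.h_joins.symm⟩]
    inner_src := by
      intro k hk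
      obtain rfl := Finset.mem_singleton.1 hk
      rcases sx.h_joins with ⟨h, h'⟩ | ⟨h, h'⟩ <;> simp [h]
    inner_tgt := by
      intro k hk
      obtain rfl := Finset.mem_singleton.1 hk
      rcases sx.h_joins with ⟨h, h'⟩ | ⟨h, h'⟩ <;> simp [h']
    sum_eq := by
      intro φ
      rw [← Finset.sum_sdiff hS, Finset.sum_insert (by simp [sx.f_ne_g, sx.f_ne_h, n14, n15]),
        Finset.sum_insert (by simp [sx.g_ne_h, n24, n25]),
        Finset.sum_insert (by simp [sy.f_ne_g, sy.f_ne_h]), Finset.sum_pair sy.g_ne_h,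
        Fin.sum_univ_two, Fin.sum_univ_two]
      simp only [Finset.sum_singleton, Matrix.cons_val_zero, Matrix.cons_val_one]
      ring }

/-- Deletion of the ends of an edge `xy`, where `x` is adjacent to an end `u` of the prescribed
edge `e`. As the new edge at `u` is adjacent to `e`, a perfect matching of the reduced multigraph
that contains `e` uses at most one of the two new edges, and so extends. -/
theorem exists_isPM_of_delete_edge {u v x y x' y₁ y₂ : ν} {f₁ f₂ f₃ f₄ f₅ : ε}
    (hI : G.Irreducible)
    (ih : ∀ H : Multigraph ν ε, H.verts.card < G.verts.card → H.Cubic → H.Bridgeless →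
      OddQuelling κ H)
    (he : e ∈ G.edges) (hj : G.Joins e u v) (hef : e ≠ f₁)
    (sx : G.Star x f₁ f₂ f₃ u x' y) (sy : G.Star y f₃ f₄ f₅ x y₁ y₂)
    (hc : G.EvenColouring col) (h14 : col f₁ = col f₄) (h25 : col f₂ = col f₅) :
    ∃ M, G.IsPM M ∧ e ∈ M ∧ G.HitsOdd col M := by
  have s := surgery_edge hI sx sy
  have hxv : x ≠ v := fun h =>
    hef (hI.eq_of_joins he sx.f_mem hj (h ▸ sx.f_joins.symm))
  have hyv : y ≠ v := fun h =>
    hI.no_triangle sx.f_mem he sx.h_mem sx.f_joins hj (h ▸ sx.h_joins)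
  have hxu : x ≠ u := hI.ne_of_joins sx.f_mem sx.f_joins
  have hyu : y ≠ u := fun h =>
    sx.f_ne_h (hI.eq_of_joins sx.f_mem sx.h_mem sx.f_joins (h ▸ sx.h_joins))
  have hex : ∀ d, ¬ G.Joins e x d := fun d hd => by
    rcases hj.eq_or_eq hd with h | h
    exacts [hxu h, hxv h]
  have hey : ∀ d, ¬ G.Joins e y d := fun d hd => by
    rcases hj.eq_or_eq hd with h | h
    exacts [hyu h, hyv h]
  have heR : e ∈ G.edges \ {f₁, f₂, f₃, f₄, f₅} := by
    simp only [Finset.mem_sdiff, Finset.mem_insert, Finset.mem_singleton, not_or]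
    refine ⟨he, ?_, ?_, ?_, ?_, ?_⟩ <;> rintro rfl
    exacts [hex _ sx.f_joins, hex _ sx.g_joins, hex _ sx.h_joins, hey _ sy.g_joins,
      hey _ sy.h_joins]
  have hcol : ∀ j, col (![f₁, f₂] j) = col (![f₄, f₅] j) := by
    intro j
    fin_cases j
    exacts [h14, h25]
  have hB := s.bridgeless (by simp) hI.bridgeless hI.trivial_cuts
  obtain ⟨M, hM, heM, hit⟩ := ih s.graph s.card_lt (s.cubic hI.cubic) hB e
    (Finset.mem_union_left _ heR) col (s.evenColouring hc hcol)
  have hf1 : f₁ ∉ M := by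
    intro h1
    exact hef (hM.eq_of_joins heM h1 (s.joins_rest_of_joins heR hj) (s.joins_new 0))
  have hxy := hI.ne_of_joins sx.h_mem sx.h_joins
  -- the edges at `x` and `y` that replace the new edges
  set T : Finset ε := if f₂ ∈ M then {f₂, f₅} else {f₃} with hT
  have hne25 : f₂ ≠ f₅ := by
    rintro rfl
    rcases sy.h_joins.eq_or_eq sx.g_joins with h | h
    · exact hxy h
    · exact sy.f_ne_h (hI.eq_of_joins sy.f_mem sy.h_mem sy.f_joins (h ▸ sy.h_joins))
  have hpm := s.isPM_extend hM (T := T)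
    (by
      intro k hk
      rw [hT] at hk
      split_ifs at hk
      · simp only [Finset.mem_insert, Finset.mem_singleton] at hk
        rcases hk with rfl | rfl
        exacts [sx.g_mem, sy.h_mem]
      · obtain rfl := Finset.mem_singleton.1 hk
        exact sx.h_mem)
    (by
      rw [Finset.disjoint_right]
      intro k hk
      rw [hT] at hk
      split_ifs at hk <;> simp only [Finset.mem_insert, Finset.mem_singleton] at hk ⊢
      · rcases hk with rfl | rfl <;> simp
      · simp [hk])
    (by
      intro w hw
      simp only [Finset.mem_insert, Finset.mem_singleton, not_or] at hw
      rw [Fin.sum_univ_two, hT]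
      by_cases h2 : f₂ ∈ M
      · simp [h2, hf1, Finset.sum_pair hne25, sx.g_joins.inc_eq, sy.h_joins.inc_eq,
          Ne.symm hw.1, Ne.symm hw.2]
      · simp [h2, hf1, sx.h_joins.inc_eq, Ne.symm hw.1, Ne.symm hw.2])
    (by
      intro w hw
      simp only [Finset.mem_insert, Finset.mem_singleton] at hw
      have n1 := s.left_notMem 1
      have n2 := s.right_notMem 1
      simp only [Matrix.cons_val_one, Matrix.cons_val_zero, Finset.mem_insert,
        Finset.mem_singleton, not_or] at n1 n2
      rw [hT]
      by_cases h2 : f₂ ∈ M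
      · rw [if_pos h2, Finset.sum_pair hne25, sx.g_joins.inc_eq, sy.h_joins.inc_eq]
        rcases hw with rfl | rfl
        · simp [n1, n2, hxy.symm]
        · simp [n1, n2, hxy]
      · rw [if_neg h2, Finset.sum_singleton, sx.h_joins.inc_eq]
        rcases hw with rfl | rfl
        · simp [hxy.symm]
        · simp [hxy])
  refine ⟨_, hpm, Finset.mem_union_left _ (Finset.mem_filter.2 ⟨heM, heR⟩), ?_⟩
  intro i hi
  obtain ⟨k, hk, hki⟩ := hit i (s.odd_card (by
    have h := hc y (sy.f_joins.left_mem sy.f_mem) i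
    have h2 := sy.sum_eq hI.bridgeless hI.cubic (fun k => if col k = some i then 1 else 0) G.edges
      subset_rfl
    simp only [sy.f_mem, sy.g_mem, sy.h_mem, if_true, mul_ite, mul_one, mul_zero] at h2
    rw [Finset.sum_filter, h2] at h
    rw [Fin.sum_univ_two, Finset.sum_singleton]
    simp only [Matrix.cons_val_zero, Matrix.cons_val_one]
    convert h using 1
    by_cases h3 : col f₃ = some i <;> by_cases h4 : col f₄ = some i <;>
      by_cases h5 : col f₅ = some i <;> simp [h3, h4, h5]) hi)
  refine ⟨k, ?_, hki⟩
  rcases Finset.mem_union.1 (hM.1 hk) with h | h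
  · exact Finset.mem_union_left _ (Finset.mem_filter.2 ⟨hk, h⟩)
  · obtain ⟨j, -, rfl⟩ := Finset.mem_image.1 h
    fin_cases j
    · exact absurd hk hf1
    · refine Finset.mem_union_right _ ?_
      rw [hT, if_pos (show f₂ ∈ M from hk)]
      simp

/-! ### Deletion of a coloured path -/

/-- Removal of the colour `i` from a colouring. -/
def eraseColour (col : ε → Option κ) (i : κ) (f : ε) : Option κ :=
  if col f = some i then none else col f

theorem eraseColour_of_eq_none {i : κ} (h : col f = none) : eraseColour col i f = none := by
  simp [eraseColour, h]

theorem eraseColour_of_eq_some {i : κ} (h : col f = some i) : eraseColour col i f = none := by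
  simp [eraseColour, h]

theorem eraseColour_eq_some_iff {i j : κ} :
    eraseColour col i f = some j ↔ col f = some j ∧ j ≠ i := by
  unfold eraseColour
  split_ifs with h
  · simp only [h, Option.some.injEq, false_iff, not_and, not_not]
    exact fun h => h.symm
  · refine ⟨fun h' => ⟨h', ?_⟩, fun h' => h'.1⟩
    rintro rfl
    exact h h'

theorem EvenColouring.erase (hc : G.EvenColouring col) (i : κ) :
    G.EvenColouring (eraseColour col i) := by
  intro w hw j
  by_cases hj : j = i
  · simp [eraseColour_eq_some_iff, hj]
  · simpa [eraseColour_eq_some_iff, hj] using hc w hw j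

/-- A matching that meets the odd colour classes after removal of the colour `i`, and that meets
the colour `i` itself, meets all odd colour classes. -/
theorem HitsOdd.of_erase {i : κ} (h : G.HitsOdd (eraseColour col i) M)
    (hi : ∃ f ∈ M, col f = some i) : G.HitsOdd col M := by
  intro j hj
  by_cases hji : j = i
  · rwa [hji]
  · obtain ⟨f, hf, hfj⟩ := h j (by simpa [eraseColour_eq_some_iff, hji] using hj)
    exact ⟨f, hf, (eraseColour_eq_some_iff.1 hfj).1⟩

theorem Joins.ne_of_ne (h1 : G.Joins f a b) (h2 : G.Joins g x y) (ha : x ≠ a) (hb : x ≠ b) :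
    g ≠ f := by
  rintro rfl
  rcases h1.eq_or_eq h2 with h | h
  exacts [ha h, hb h]

/-- The configuration in which a colour `i` is given up: a path `x`, `p`, `m`, `n`, where `x` is a
neighbour of the end `u` of the prescribed edge, no edge at `x` is coloured, and `p`, `m`, `n` are
consecutive on a cycle of colour `i`. The remaining neighbours are `q` of `x`, `l` of `p`, `t` of
`m`, and `r`, `t'` of `n`, with `r` on the same cycle. -/
structure ColouredPath (G : Multigraph ν ε) (col : ε → Option κ) (i : κ)
    (x p m n u q l t r t' : ν) (f₁ f₂ f₃ f₄ f₅ f₆ f₇ f₈ f₉ : ε) : Prop where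
  sx : G.Star x f₁ f₂ f₃ u q p
  sp : G.Star p f₃ f₄ f₅ x l m
  sm : G.Star m f₅ f₆ f₇ p t n
  sn : G.Star n f₇ f₈ f₉ m r t'
  c₁ : col f₁ = none
  c₂ : col f₂ = none
  c₃ : col f₃ = none
  c₄ : col f₄ = some i
  c₅ : col f₅ = some i
  c₆ : col f₆ = none
  c₇ : col f₇ = some i
  c₈ : col f₈ = some i
  c₉ : col f₉ = none
  hq : ∀ k ∈ G.edges, ∀ d, G.Joins k q d → col k ≠ some i
  hu : ∀ k ∈ G.edges, ∀ d, G.Joins k u d → col k ≠ some i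
  ut' : u ≠ t'

namespace ColouredPath

variable {i : κ} {p m n u v q l t r t' : ν} {f₁ f₂ f₃ f₄ f₅ f₆ f₇ f₈ f₉ : ε}

theorem ne_of_coloured (z : G.ColouredPath col i x p m n u q l t r t' f₁ f₂ f₃ f₄ f₅ f₆ f₇ f₈ f₉)
    (ha : ∀ k ∈ G.edges, ∀ d, G.Joins k a d → col k ≠ some i) : p ≠ a ∧ m ≠ a ∧ n ≠ a := by
  refine ⟨?_, ?_, ?_⟩ <;> rintro rfl
  exacts [ha _ z.sp.g_mem _ z.sp.g_joins z.c₄, ha _ z.sm.f_mem _ z.sm.f_joins z.c₅,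
    ha _ z.sn.f_mem _ z.sn.f_joins z.c₇]

theorem x_not_coloured
    (z : G.ColouredPath col i x p m n u q l t r t' f₁ f₂ f₃ f₄ f₅ f₆ f₇ f₈ f₉) :
    ∀ k ∈ G.edges, ∀ d, G.Joins k x d → col k ≠ some i := by
  intro k hk d hd
  rcases z.sx.eq_of_joins k hk d hd with rfl | rfl | rfl
  · simp [z.c₁]
  · simp [z.c₂]
  · simp [z.c₃]

theorem n_ne_p (z : G.ColouredPath col i x p m n u q l t r t' f₁ f₂ f₃ f₄ f₅ f₆ f₇ f₈ f₉)
    (hI : G.Irreducible) : n ≠ p := by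
  rintro rfl
  exact z.sm.f_ne_h (hI.eq_of_joins z.sm.f_mem z.sm.h_mem z.sm.f_joins z.sm.h_joins)

theorem edges_ne (z : G.ColouredPath col i x p m n u q l t r t' f₁ f₂ f₃ f₄ f₅ f₆ f₇ f₈ f₉)
    (hI : G.Irreducible) :
    f₁ ∉ ({f₂, f₃, f₄, f₅, f₆, f₇, f₈, f₉} : Finset ε) ∧
    f₂ ∉ ({f₃, f₄, f₅, f₆, f₇, f₈, f₉} : Finset ε) ∧
    f₃ ∉ ({f₄, f₅, f₆, f₇, f₈, f₉} : Finset ε) ∧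
    f₄ ∉ ({f₅, f₆, f₇, f₈, f₉} : Finset ε) ∧ f₅ ∉ ({f₆, f₇, f₈, f₉} : Finset ε) ∧
    f₆ ∉ ({f₇, f₈, f₉} : Finset ε) ∧ f₇ ∉ ({f₈, f₉} : Finset ε) ∧ f₈ ≠ f₉ := by
  have nc : ∀ {k l : ε}, col k = none → col l = some i → k ≠ l := by
    rintro k _ h1 h2 rfl
    simp [h1] at h2
  have cn : ∀ {k l : ε}, col k = some i → col l = none → k ≠ l := fun h1 h2 => (nc h2 h1).symm
  obtain ⟨hpx, hmx, hnx⟩ := z.ne_of_coloured z.x_not_coloured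
  obtain ⟨hpu, hmu, hnu⟩ := z.ne_of_coloured z.hu
  obtain ⟨hpq, hmq, hnq⟩ := z.ne_of_coloured z.hq
  have hpm := hI.ne_of_joins z.sp.h_mem z.sp.h_joins
  have hmn := hI.ne_of_joins z.sm.h_mem z.sm.h_joins
  have hnp := z.n_ne_p hI
  have n16 := (z.sx.f_joins.ne_of_ne z.sm.g_joins hmx hmu).symm
  have n26 := (z.sx.g_joins.ne_of_ne z.sm.g_joins hmx hmq).symm
  have n36 := (z.sx.h_joins.ne_of_ne z.sm.g_joins hmx hpm.symm).symm
  have n19 := (z.sx.f_joins.ne_of_ne z.sn.h_joins hnx hnu).symm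
  have n29 := (z.sx.g_joins.ne_of_ne z.sn.h_joins hnx hnq).symm
  have n39 := (z.sx.h_joins.ne_of_ne z.sn.h_joins hnx hnp).symm
  have hnt : n ≠ t := fun h =>
    z.sm.g_ne_h (hI.eq_of_joins z.sm.g_mem z.sm.h_mem z.sm.g_joins (h ▸ z.sm.h_joins))
  have n69 := (z.sm.g_joins.ne_of_ne z.sn.h_joins hmn.symm hnt).symm
  have n47 := z.sm.h_joins.ne_of_ne z.sp.g_joins hpm hnp.symm
  have hpr : p ≠ r := fun h =>
    hI.no_triangle z.sp.h_mem z.sm.h_mem z.sn.g_mem z.sp.h_joins z.sm.h_joins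
      (h ▸ z.sn.g_joins).symm
  have hmr : m ≠ r := fun h =>
    z.sn.f_ne_g (hI.eq_of_joins z.sn.f_mem z.sn.g_mem z.sn.f_joins (h ▸ z.sn.g_joins))
  have n48 := z.sn.g_joins.ne_of_ne z.sp.g_joins hnp.symm hpr
  have n58 := z.sn.g_joins.ne_of_ne z.sm.f_joins hmn hmr
  simp only [Finset.mem_insert, Finset.mem_singleton, not_or]
  exact ⟨⟨z.sx.f_ne_g, z.sx.f_ne_h, nc z.c₁ z.c₄, nc z.c₁ z.c₅, n16, nc z.c₁ z.c₇, nc z.c₁ z.c₈,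
    n19⟩, ⟨z.sx.g_ne_h, nc z.c₂ z.c₄, nc z.c₂ z.c₅, n26, nc z.c₂ z.c₇, nc z.c₂ z.c₈, n29⟩,
    ⟨z.sp.f_ne_g, z.sp.f_ne_h, n36, nc z.c₃ z.c₇, nc z.c₃ z.c₈, n39⟩,
    ⟨z.sp.g_ne_h, cn z.c₄ z.c₆, n47, n48, cn z.c₄ z.c₉⟩,
    ⟨z.sm.f_ne_g, z.sm.f_ne_h, n58, cn z.c₅ z.c₉⟩, ⟨z.sm.g_ne_h, nc z.c₆ z.c₈, n69⟩,
    ⟨z.sn.f_ne_g, z.sn.f_ne_h⟩, z.sn.g_ne_h⟩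

set_option maxHeartbeats 1000000 in
/-- The edges avoiding the path `x`, `p`, `m`, `n` and the edges at it. -/
theorem surgery (z : G.ColouredPath col i x p m n u q l t r t' f₁ f₂ f₃ f₄ f₅ f₆ f₇ f₈ f₉)
    (hI : G.Irreducible) :
    G.Surgery {x, p, m, n} (G.edges \ {f₁, f₂, f₃, f₄, f₅, f₆, f₇, f₈, f₉}) {f₃, f₅, f₇}
      ![f₁, f₂, f₆] ![f₉, f₄, f₈] ![u, q, t] ![t', l, r] := by
  obtain ⟨hpx, hmx, hnx⟩ := z.ne_of_coloured z.x_not_coloured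
  obtain ⟨hpu, hmu, hnu⟩ := z.ne_of_coloured z.hu
  obtain ⟨hpq, hmq, hnq⟩ := z.ne_of_coloured z.hq
  have hpm := hI.ne_of_joins z.sp.h_mem z.sp.h_joins
  have hmn := hI.ne_of_joins z.sm.h_mem z.sm.h_joins
  have hnp := z.n_ne_p hI
  obtain ⟨e1, e2, e3, e4, e5, e6, e7, e8⟩ := z.edges_ne hI
  have hS : ({f₁, f₂, f₃, f₄, f₅, f₆, f₇, f₈, f₉} : Finset ε) ⊆ G.edges := by
    intro k hk
    simp only [Finset.mem_insert, Finset.mem_singleton] at hk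
    rcases hk with rfl | rfl | rfl | rfl | rfl | rfl | rfl | rfl | rfl
    exacts [z.sx.f_mem, z.sx.g_mem, z.sx.h_mem, z.sp.g_mem, z.sp.h_mem, z.sm.g_mem, z.sm.h_mem,
      z.sn.g_mem, z.sn.h_mem]
  have hR : ∀ k ∈ G.edges \ {f₁, f₂, f₃, f₄, f₅, f₆, f₇, f₈, f₉},
      ∀ w ∈ ({x, p, m, n} : Finset ν), ∀ d, ¬ G.Joins k w d := by
    intro k hk w hw d hd
    simp only [Finset.mem_sdiff, Finset.mem_insert, Finset.mem_singleton, not_or] at hk hw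
    rcases hw with rfl | rfl | rfl | rfl
    · have := z.sx.eq_of_joins k hk.1 d hd
      tauto
    · have := z.sp.eq_of_joins k hk.1 d hd
      tauto
    · have := z.sm.eq_of_joins k hk.1 d hd
      tauto
    · have := z.sn.eq_of_joins k hk.1 d hd
      tauto
  simp only [Finset.mem_insert, Finset.mem_singleton, not_or] at e1 e2 e3 e4 e5 e6 e7
  have hxu := hI.ne_of_joins z.sx.f_mem z.sx.f_joins
  have hxq := hI.ne_of_joins z.sx.g_mem z.sx.g_joins
  have htx : t ≠ x := fun h => by
    rcases z.sx.eq_of_joins _ z.sm.g_mem m (h ▸ z.sm.g_joins).symm with h | h | h <;> tauto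
  have htp : t ≠ p := fun h =>
    z.sm.f_ne_g (hI.eq_of_joins z.sm.f_mem z.sm.g_mem z.sm.f_joins (h ▸ z.sm.g_joins))
  have htm := (hI.ne_of_joins z.sm.g_mem z.sm.g_joins).symm
  have htn : t ≠ n := fun h =>
    z.sm.g_ne_h (hI.eq_of_joins z.sm.g_mem z.sm.h_mem z.sm.g_joins (h ▸ z.sm.h_joins))
  have htx' : t' ≠ x := fun h => by
    rcases z.sx.eq_of_joins _ z.sn.h_mem n (h ▸ z.sn.h_joins).symm with h | h | h <;> tauto
  have htp' : t' ≠ p := fun h =>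
    hI.no_triangle z.sp.h_mem z.sm.h_mem z.sn.h_mem z.sp.h_joins z.sm.h_joins
      (h ▸ z.sn.h_joins).symm
  have htm' : t' ≠ m := fun h =>
    z.sn.f_ne_h (hI.eq_of_joins z.sn.f_mem z.sn.h_mem z.sn.f_joins (h ▸ z.sn.h_joins))
  have htn' := (hI.ne_of_joins z.sn.h_mem z.sn.h_joins).symm
  have hlx : l ≠ x := fun h =>
    z.sp.f_ne_g (hI.eq_of_joins z.sp.f_mem z.sp.g_mem z.sp.f_joins (h ▸ z.sp.g_joins))
  have hlp := (hI.ne_of_joins z.sp.g_mem z.sp.g_joins).symm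
  have hlm : l ≠ m := fun h =>
    z.sp.g_ne_h (hI.eq_of_joins z.sp.g_mem z.sp.h_mem z.sp.g_joins (h ▸ z.sp.h_joins))
  have hln : l ≠ n := fun h =>
    hI.no_triangle z.sp.h_mem z.sm.h_mem z.sp.g_mem z.sp.h_joins z.sm.h_joins
      (h ▸ z.sp.g_joins)
  have hrx : r ≠ x := fun h => by
    rcases z.sx.eq_of_joins _ z.sn.g_mem n (h ▸ z.sn.g_joins).symm with h | h | h <;> tauto
  have hrp : r ≠ p := fun h =>
    hI.no_triangle z.sp.h_mem z.sm.h_mem z.sn.g_mem z.sp.h_joins z.sm.h_joins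
      (h ▸ z.sn.g_joins).symm
  have hrm : r ≠ m := fun h =>
    z.sn.f_ne_g (hI.eq_of_joins z.sn.f_mem z.sn.g_mem z.sn.f_joins (h ▸ z.sn.g_joins))
  have hrn := (hI.ne_of_joins z.sn.g_mem z.sn.g_joins).symm
  exact {
    subset := by
      intro v hv
      simp only [Finset.mem_insert, Finset.mem_singleton] at hv
      rcases hv with rfl | rfl | rfl | rfl
      exacts [z.sx.f_joins.left_mem z.sx.f_mem, z.sp.f_joins.left_mem z.sp.f_mem,
        z.sm.f_joins.left_mem z.sm.f_mem, z.sn.f_joins.left_mem z.sn.f_mem]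
    two_le := (Finset.card_pair hpx.symm).ge.trans (Finset.card_le_card (by
      intro v hv
      simp only [Finset.mem_insert, Finset.mem_singleton] at hv ⊢
      tauto))
    rest_subset := Finset.sdiff_subset
    rest_src := fun k hk hP => hR k hk _ hP _ (G.joins_src_tgt k)
    rest_tgt := fun k hk hP => hR k hk _ hP _ (G.joins_src_tgt k).symm
    injective := by
      have h12 : f₁ ≠ f₂ := e1.1
      have h16 : f₁ ≠ f₆ := e1.2.2.2.2.1
      have h26 : f₂ ≠ f₆ := e2.2.2.2.1
      clear * - h12 h16 h26
      intro j k hjk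
      fin_cases j <;> fin_cases k <;> simp_all [eq_comm]
    notMem_rest := by
      intro j
      fin_cases j <;> simp
    left_mem := by
      intro j
      fin_cases j
      exacts [z.sx.f_joins.right_mem z.sx.f_mem, z.sx.g_joins.right_mem z.sx.g_mem,
        z.sm.g_joins.right_mem z.sm.g_mem]
    left_notMem := by
      intro j
      fin_cases j <;> simp [hxu.symm, hpu.symm, hmu.symm, hnu.symm, hxq.symm, hpq.symm, hmq.symm,
        hnq.symm, htx, htp, htm, htn]
    right_mem := by
      intro j
      fin_cases j
      exacts [z.sn.h_joins.right_mem z.sn.h_mem, z.sp.g_joins.right_mem z.sp.g_mem,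
        z.sn.g_joins.right_mem z.sn.g_mem]
    right_notMem := by
      intro j
      fin_cases j <;> simp [htx', htp', htm', htn', hlx, hlp, hlm, hln, hrx, hrp, hrm, hrn]
    ne := by
      intro j
      fin_cases j
      · exact z.ut'
      · rintro (h : q = l)
        exact hI.no_triangle z.sx.h_mem z.sp.g_mem z.sx.g_mem z.sx.h_joins z.sp.g_joins
          (h ▸ z.sx.g_joins)
      · rintro (h : t = r)
        exact hI.no_triangle z.sm.h_mem z.sn.g_mem z.sm.g_mem z.sm.h_joins z.sn.g_joins
          (h ▸ z.sm.g_joins)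
    left_joins := by
      intro j
      fin_cases j
      exacts [⟨x, by simp, z.sx.f_joins.symm⟩, ⟨x, by simp, z.sx.g_joins.symm⟩,
        ⟨m, by simp, z.sm.g_joins.symm⟩]
    right_joins := by
      intro j
      fin_cases j
      exacts [⟨n, by simp, z.sn.h_joins.symm⟩, ⟨p, by simp, z.sp.g_joins.symm⟩,
        ⟨n, by simp, z.sn.g_joins.symm⟩]
    inner_src := by
      intro k hk
      simp only [Finset.mem_insert, Finset.mem_singleton] at hk
      rcases hk with rfl | rfl | rfl
      · rcases z.sx.h_joins with ⟨h, h'⟩ | ⟨h, h'⟩ <;> simp [h]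
      · rcases z.sp.h_joins with ⟨h, h'⟩ | ⟨h, h'⟩ <;> simp [h]
      · rcases z.sm.h_joins with ⟨h, h'⟩ | ⟨h, h'⟩ <;> simp [h]
    inner_tgt := by
      intro k hk
      simp only [Finset.mem_insert, Finset.mem_singleton] at hk
      rcases hk with rfl | rfl | rfl
      · rcases z.sx.h_joins with ⟨h, h'⟩ | ⟨h, h'⟩ <;> simp [h']
      · rcases z.sp.h_joins with ⟨h, h'⟩ | ⟨h, h'⟩ <;> simp [h']
      · rcases z.sm.h_joins with ⟨h, h'⟩ | ⟨h, h'⟩ <;> simp [h']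
    sum_eq := by
      intro φ
      rw [← Finset.sum_sdiff hS, Finset.sum_insert (by simpa using e1),
        Finset.sum_insert (by simpa using e2), Finset.sum_insert (by simpa using e3),
        Finset.sum_insert (by simpa using e4), Finset.sum_insert (by simpa using e5),
        Finset.sum_insert (by simpa using e6), Finset.sum_insert (by simpa using e7),
        Finset.sum_pair e8, Finset.sum_insert (by simp [e3]), Finset.sum_pair e5.2.1,
        Fin.sum_univ_three, Fin.sum_univ_three]
      simp only [Matrix.cons_val_zero, Matrix.cons_val_one, Matrix.cons_val]
      ring }

set_option maxHeartbeats 1000000 in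
/-- Deletion of a coloured path. The colour `i` is removed from the reduced multigraph. It is met
nevertheless: in every extension of the matching, `n` is matched along the cycle of colour `i`. -/
theorem exists_isPM (z : G.ColouredPath col i x p m n u q l t r t' f₁ f₂ f₃ f₄ f₅ f₆ f₇ f₈ f₉)
    (hI : G.Irreducible)
    (ih : ∀ H : Multigraph ν ε, H.verts.card < G.verts.card → H.Cubic → H.Bridgeless →
      OddQuelling κ H)
    (he : e ∈ G.edges) (hj : G.Joins e u v) (hef : e ≠ f₁)
    (hv : ∀ k ∈ G.edges, ∀ d, G.Joins k v d → col k ≠ some i) (hc : G.EvenColouring col) :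
    ∃ M, G.IsPM M ∧ e ∈ M ∧ G.HitsOdd col M := by
  have s := z.surgery hI
  obtain ⟨hpx, hmx, hnx⟩ := z.ne_of_coloured z.x_not_coloured
  obtain ⟨hpu, hmu, hnu⟩ := z.ne_of_coloured z.hu
  obtain ⟨hpq, hmq, hnq⟩ := z.ne_of_coloured z.hq
  obtain ⟨hpv, hmv, hnv⟩ := z.ne_of_coloured hv
  have hpm := hI.ne_of_joins z.sp.h_mem z.sp.h_joins
  have hmn := hI.ne_of_joins z.sm.h_mem z.sm.h_joins
  have hnp := z.n_ne_p hI
  obtain ⟨e1, e2, e3, e4, e5, e6, e7, e8⟩ := z.edges_ne hI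
  simp only [Finset.mem_insert, Finset.mem_singleton, not_or] at e1 e2 e3 e4 e5 e6 e7
  have hxu := hI.ne_of_joins z.sx.f_mem z.sx.f_joins
  have hxv : x ≠ v := fun h =>
    hef (hI.eq_of_joins he z.sx.f_mem hj (h ▸ z.sx.f_joins.symm))
  have heP : ∀ w ∈ ({x, p, m, n} : Finset ν), ∀ d, ¬ G.Joins e w d := by
    intro w hw d hd
    simp only [Finset.mem_insert, Finset.mem_singleton] at hw
    rcases hj.eq_or_eq hd with h | h <;> rcases hw with rfl | rfl | rfl | rfl <;> contradiction
  have heR : e ∈ G.edges \ {f₁, f₂, f₃, f₄, f₅, f₆, f₇, f₈, f₉} := by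
    simp only [Finset.mem_sdiff, Finset.mem_insert, Finset.mem_singleton, not_or]
    refine ⟨he, hef, ?_, ?_, ?_, ?_, ?_, ?_, ?_, ?_⟩ <;> rintro rfl
    exacts [heP x (by simp) _ z.sx.g_joins, heP x (by simp) _ z.sx.h_joins,
      heP p (by simp) _ z.sp.g_joins, heP p (by simp) _ z.sp.h_joins,
      heP m (by simp) _ z.sm.g_joins, heP m (by simp) _ z.sm.h_joins,
      heP n (by simp) _ z.sn.g_joins, heP n (by simp) _ z.sn.h_joins]
  have d1 : eraseColour col i f₁ = none := eraseColour_of_eq_none z.c₁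
  have d2 : eraseColour col i f₂ = none := eraseColour_of_eq_none z.c₂
  have d3 : eraseColour col i f₃ = none := eraseColour_of_eq_none z.c₃
  have d4 : eraseColour col i f₄ = none := eraseColour_of_eq_some z.c₄
  have d5 : eraseColour col i f₅ = none := eraseColour_of_eq_some z.c₅
  have d6 : eraseColour col i f₆ = none := eraseColour_of_eq_none z.c₆
  have d7 : eraseColour col i f₇ = none := eraseColour_of_eq_some z.c₇
  have d8 : eraseColour col i f₈ = none := eraseColour_of_eq_some z.c₈
  have d9 : eraseColour col i f₉ = none := eraseColour_of_eq_none z.c₉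
  have hcol : ∀ j, eraseColour col i (![f₁, f₂, f₆] j) = eraseColour col i (![f₉, f₄, f₈] j) := by
    intro j
    fin_cases j
    exacts [d1.trans d9.symm, d2.trans d4.symm, d6.trans d8.symm]
  have hB := s.bridgeless (by simp) hI.bridgeless hI.trivial_cuts
  obtain ⟨M, hM, heM, hit⟩ := ih s.graph s.card_lt (s.cubic hI.cubic) hB e
    (Finset.mem_union_left _ heR) _ (s.evenColouring (hc.erase i) hcol)
  have hf1 : f₁ ∉ M := fun h1 =>
    hef (hM.eq_of_joins heM h1 (s.joins_rest_of_joins heR hj) (s.joins_new 0))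
  -- the edges at `x` and `p`, and those at `m` and `n`, that replace the new edges
  set S : Finset ε := if f₂ ∈ M then {f₂, f₄} else {f₃} with hS
  set T : Finset ε := if f₆ ∈ M then {f₆, f₈} else {f₇} with hT
  have hSsub : S ⊆ {f₂, f₃, f₄} := by
    rw [hS]
    intro k hk
    split_ifs at hk <;> simp only [Finset.mem_insert, Finset.mem_singleton] at hk ⊢ <;> tauto
  have hTsub : T ⊆ {f₆, f₇, f₈} := by
    rw [hT]
    intro k hk
    split_ifs at hk <;> simp only [Finset.mem_insert, Finset.mem_singleton] at hk ⊢ <;> tauto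
  have hST : Disjoint S T := by
    refine Finset.disjoint_of_subset_left hSsub (Finset.disjoint_of_subset_right hTsub ?_)
    simp only [Finset.disjoint_insert_left, Finset.disjoint_singleton_left, Finset.mem_insert,
      Finset.mem_singleton, not_or]
    tauto
  have hSsum : ∀ w, ∑ f ∈ S, G.inc f w =
      if f₂ ∈ M then G.inc f₂ w + G.inc f₄ w else G.inc f₃ w := by
    intro w
    rw [hS]
    split_ifs
    · exact Finset.sum_pair e2.2.1
    · exact Finset.sum_singleton _ _
  have hTsum : ∀ w, ∑ f ∈ T, G.inc f w =
      if f₆ ∈ M then G.inc f₆ w + G.inc f₈ w else G.inc f₇ w := by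
    intro w
    rw [hT]
    split_ifs
    · exact Finset.sum_pair e6.2.1
    · exact Finset.sum_singleton _ _
  have l1 := s.left_notMem 1
  have l2 := s.left_notMem 2
  have r1 := s.right_notMem 1
  have r2 := s.right_notMem 2
  simp only [Matrix.cons_val_one, Matrix.cons_val_zero, Matrix.cons_val, Finset.mem_insert,
    Finset.mem_singleton, not_or] at l1 l2 r1 r2
  have hpm' := s.isPM_extend hM (T := S ∪ T)
    (by
      intro k hk
      have hk' := (Finset.union_subset_union hSsub hTsub) hk
      simp only [Finset.mem_union, Finset.mem_insert, Finset.mem_singleton] at hk'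
      rcases hk' with (rfl | rfl | rfl) | rfl | rfl | rfl
      exacts [z.sx.g_mem, z.sx.h_mem, z.sp.g_mem, z.sm.g_mem, z.sm.h_mem, z.sn.g_mem])
    (by
      rw [Finset.disjoint_right]
      intro k hk
      have hk' := (Finset.union_subset_union hSsub hTsub) hk
      simp only [Finset.mem_union, Finset.mem_insert, Finset.mem_singleton] at hk'
      simp only [Finset.mem_sdiff, Finset.mem_insert, Finset.mem_singleton]
      tauto)
    (by
      intro w hw
      simp only [Finset.mem_insert, Finset.mem_singleton, not_or] at hw
      obtain ⟨w1, w2, w3, w4⟩ := hw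
      rw [Fin.sum_univ_three, Finset.sum_union hST, hSsum, hTsum, z.sx.g_joins.inc_eq,
        z.sp.g_joins.inc_eq, z.sx.h_joins.inc_eq, z.sm.g_joins.inc_eq, z.sn.g_joins.inc_eq,
        z.sm.h_joins.inc_eq]
      by_cases h2 : f₂ ∈ M <;> by_cases h6 : f₆ ∈ M <;>
        simp [h2, h6, hf1, Ne.symm w1, Ne.symm w2, Ne.symm w3, Ne.symm w4] <;> congr!)
    (by
      intro w hw
      simp only [Finset.mem_insert, Finset.mem_singleton] at hw
      rw [Finset.sum_union hST, hSsum, hTsum, z.sx.g_joins.inc_eq,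
        z.sp.g_joins.inc_eq, z.sx.h_joins.inc_eq, z.sm.g_joins.inc_eq, z.sn.g_joins.inc_eq,
        z.sm.h_joins.inc_eq]
      rcases hw with rfl | rfl | rfl | rfl <;> by_cases h2 : f₂ ∈ M <;> by_cases h6 : f₆ ∈ M <;>
        simp [h2, h6, l1, l2, r1, r2, hpx, hmx, hnx, hpm, hmn, hnp, hpx.symm, hmx.symm, hnx.symm,
          hpm.symm, hmn.symm, hnp.symm])
  refine ⟨_, hpm', Finset.mem_union_left _ (Finset.mem_filter.2 ⟨heM, heR⟩), ?_⟩
  refine HitsOdd.of_erase (i := i) ?_ ?_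
  · intro j hjo
    obtain ⟨k, hk, hkj⟩ := hit j (s.odd_card (by
      rw [Fin.sum_univ_three, Finset.sum_eq_zero]
      · simp [d4, d8, d9]
      · intro k hk
        simp only [Finset.mem_insert, Finset.mem_singleton] at hk
        rcases hk with rfl | rfl | rfl <;> simp [d3, d5, d7]) hjo)
    refine ⟨k, ?_, hkj⟩
    rcases Finset.mem_union.1 (hM.1 hk) with h | h
    · exact Finset.mem_union_left _ (Finset.mem_filter.2 ⟨hk, h⟩)
    · obtain ⟨j', -, rfl⟩ := Finset.mem_image.1 h
      fin_cases j'
      · simp [d1] at hkj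
      · simp [d2] at hkj
      · simp [d6] at hkj
  · by_cases h6 : f₆ ∈ M
    · exact ⟨f₈, by simp [hT, h6], z.c₈⟩
    · exact ⟨f₇, by simp [hT, h6], z.c₇⟩

end ColouredPath

/-! ### Multigraphs without non-trivial three-edge cuts -/

/-- No edge at the vertex `w` is coloured. -/
def Untouched (G : Multigraph ν ε) (col : ε → Option κ) (w : ν) : Prop :=
  ∀ k ∈ G.edges, ∀ d, G.Joins k w d → col k = none

theorem Star.untouched (s : G.Star w f g h a b c) (hf : col f = none) (hg : col g = none)
    (hh : col h = none) : G.Untouched col w := by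
  intro k hk d hd
  rcases s.eq_of_joins k hk d hd with rfl | rfl | rfl <;> assumption

/-- A colour that enters a vertex leaves it again. -/
theorem EvenColouring.exists_star_of_eq_some {i : κ} (hc : G.EvenColouring col)
    (hB : G.Bridgeless) (hG : G.Cubic) (hf : f ∈ G.edges) (hj : G.Joins f w a)
    (hi : col f = some i) :
    ∃ g h b c, G.Star w f g h a b c ∧ col g = none ∧ col h = some i := by
  obtain ⟨g, h, b, c, s⟩ := exists_star hB hG hf hj
  rcases hc.star hB hG s with ⟨h1, h2⟩ | ⟨-, h2⟩ | ⟨h1, h2⟩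
  · exact ⟨h, g, c, b, s.swap, h2, h1 ▸ hi⟩
  · simp [hi] at h2
  · exact ⟨g, h, b, c, s, h2, h1 ▸ hi⟩

/-- In a perfect matching, a vertex is covered by one of the two other edges if the first edge of
its star is not used. -/
theorem Star.mem_or_mem (s : G.Star w f g h a b c) (hM : G.IsPM M) (hf : f ∉ M) :
    g ∈ M ∨ h ∈ M := by
  obtain ⟨k, hk, d, hd⟩ := hM.exists_joins (s.f_joins.left_mem s.f_mem)
  rcases s.eq_of_joins k (hM.1 hk) d hd with rfl | rfl | rfl
  exacts [absurd hk hf, Or.inl hk, Or.inr hk]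

namespace Irreducible

variable {u v q p l m : ν} {f₁ f₂ f₃ f₄ f₅ : ε}

/-- If a coloured edge joins `x` to `y ≠ u`, then the two edges of the same colour around `xy` can
be paired, and so can the two uncoloured edges. -/
theorem exists_isPM_of_ne_none (hI : G.Irreducible)
    (ih : ∀ H : Multigraph ν ε, H.verts.card < G.verts.card → H.Cubic → H.Bridgeless →
      OddQuelling κ H)
    (he : e ∈ G.edges) (hj : G.Joins e u v) (hef : e ≠ f₁) (sx : G.Star x f₁ f₂ f₃ u q p)
    (hc : G.EvenColouring col) (h3 : col f₃ ≠ none) :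
    ∃ M, G.IsPM M ∧ e ∈ M ∧ G.HitsOdd col M := by
  obtain ⟨f₄, f₅, l, m, sp⟩ := exists_star hI.bridgeless hI.cubic sx.h_mem sx.h_joins.symm
  rcases hc.star hI.bridgeless hI.cubic sx with ⟨h1, h2⟩ | ⟨h1, h2⟩ | ⟨h1, h2⟩
  · exact absurd h2 h3
  · rcases hc.star hI.bridgeless hI.cubic sp with ⟨h4, h5⟩ | ⟨h4, h5⟩ | ⟨h4, h5⟩
    · exact exists_isPM_of_delete_edge hI ih he hj hef sx sp.swap hc (h2.trans h5.symm)
        (h1.trans h4)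
    · exact absurd h5 h3
    · exact exists_isPM_of_delete_edge hI ih he hj hef sx sp hc (h2.trans h5.symm)
        (h1.trans h4)
  · rcases hc.star hI.bridgeless hI.cubic sp with ⟨h4, h5⟩ | ⟨h4, h5⟩ | ⟨h4, h5⟩
    · exact exists_isPM_of_delete_edge hI ih he hj hef sx sp hc (h1.trans h4)
        (h2.trans h5.symm)
    · exact absurd h5 h3
    · exact exists_isPM_of_delete_edge hI ih he hj hef sx sp.swap hc (h1.trans h4)
        (h2.trans h5.symm)

/-- In the absence of the desired matching, no neighbour of an end of the prescribed edge has a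
coloured edge. -/
theorem eq_none_of_star (hI : G.Irreducible)
    (ih : ∀ H : Multigraph ν ε, H.verts.card < G.verts.card → H.Cubic → H.Bridgeless →
      OddQuelling κ H)
    (he : e ∈ G.edges) (hj : G.Joins e u v) (hef : e ≠ f₁) (sx : G.Star x f₁ f₂ f₃ u q p)
    (hc : G.EvenColouring col) (hn : ¬ ∃ M, G.IsPM M ∧ e ∈ M ∧ G.HitsOdd col M) :
    col f₁ = none ∧ col f₂ = none ∧ col f₃ = none := by
  have h3 : col f₃ = none := by
    by_contra h
    exact hn (hI.exists_isPM_of_ne_none ih he hj hef sx hc h)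
  have h2 : col f₂ = none := by
    by_contra h
    exact hn (hI.exists_isPM_of_ne_none ih he hj hef sx.swap hc h)
  refine ⟨?_, h2, h3⟩
  rcases hc.star hI.bridgeless hI.cubic sx with ⟨h, -⟩ | ⟨-, h⟩ | ⟨h, -⟩
  exacts [h.trans h2, h, h.trans h3]

/-- In the absence of the desired matching, a single colour passes through each vertex at distance
two from the prescribed edge. -/
theorem exists_eq_some_of_star (hI : G.Irreducible)
    (ih : ∀ H : Multigraph ν ε, H.verts.card < G.verts.card → H.Cubic → H.Bridgeless →
      OddQuelling κ H)
    (he : e ∈ G.edges) (hj : G.Joins e u v) (hef : e ≠ f₁) (sx : G.Star x f₁ f₂ f₃ u q p)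
    (sp : G.Star p f₃ f₄ f₅ x l m)
    (hc : G.EvenColouring col) (hn : ¬ ∃ M, G.IsPM M ∧ e ∈ M ∧ G.HitsOdd col M) :
    ∃ i, col f₄ = some i ∧ col f₅ = some i := by
  obtain ⟨h1, h2, h3⟩ := hI.eq_none_of_star ih he hj hef sx hc hn
  have h45 : col f₄ = col f₅ := by
    rcases hc.star hI.bridgeless hI.cubic sp with ⟨h, h'⟩ | ⟨h, -⟩ | ⟨h, h'⟩
    exacts [(h.symm.trans h3).trans h'.symm, h, h'.trans (h3.symm.trans h)]
  rcases h4 : col f₄ with _ | i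
  · exact absurd (exists_isPM_of_delete_edge hI ih he hj hef sx sp hc (h1.trans h4.symm)
      (h2.trans (h4.symm.trans h45))) hn
  · exact ⟨i, rfl, h45.symm.trans h4⟩

theorem untouched (hI : G.Irreducible)
    (ih : ∀ H : Multigraph ν ε, H.verts.card < G.verts.card → H.Cubic → H.Bridgeless →
      OddQuelling κ H)
    (he : e ∈ G.edges) (hj : G.Joins e u v)
    (hc : G.EvenColouring col) (hn : ¬ ∃ M, G.IsPM M ∧ e ∈ M ∧ G.HitsOdd col M) :
    G.Untouched col u ∧ ∀ k ∈ G.edges, k ≠ e → ∀ d, G.Joins k u d → G.Untouched col d := by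
  have key : ∀ k ∈ G.edges, k ≠ e → ∀ d, G.Joins k u d → col k = none ∧ G.Untouched col d := by
    intro k hk hke d hd
    obtain ⟨f₂, f₃, q, p, sx⟩ := exists_star hI.bridgeless hI.cubic hk hd.symm
    obtain ⟨h1, h2, h3⟩ := hI.eq_none_of_star ih he hj hke.symm sx hc hn
    exact ⟨h1, sx.untouched h1 h2 h3⟩
  refine ⟨?_, fun k hk hke d hd => (key k hk hke d hd).2⟩
  obtain ⟨f, g, x, y, s⟩ := exists_star hI.bridgeless hI.cubic he hj
  have hf := (key f s.g_mem s.f_ne_g.symm x s.g_joins).1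
  have hg := (key g s.h_mem s.f_ne_h.symm y s.h_joins).1
  refine s.untouched ?_ hf hg
  rcases hc.star hI.bridgeless hI.cubic s with ⟨h, -⟩ | ⟨-, h⟩ | ⟨h, -⟩
  exacts [h.trans hf, h, h.trans hg]

/-- The case in which both other neighbours `p`, `q` of `x` lie on cycles of the same colour `i`.
The vertices `x` and `p` are deleted after removal of the colour `i`. Whichever of `p`, `q`
is not matched to `x` is matched along colour `i`. -/
theorem exists_isPM_of_common_colour {i : κ} {k₄ k₅ : ε} {l' m' : ν} (hI : G.Irreducible)
    (ih : ∀ H : Multigraph ν ε, H.verts.card < G.verts.card → H.Cubic → H.Bridgeless →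
      OddQuelling κ H)
    (he : e ∈ G.edges) (hj : G.Joins e u v) (hef : e ≠ f₁) (sx : G.Star x f₁ f₂ f₃ u q p)
    (sp : G.Star p f₃ f₄ f₅ x l m) (sq : G.Star q f₂ k₄ k₅ x l' m')
    (hc : G.EvenColouring col) (h1 : col f₁ = none) (h2 : col f₂ = none)
    (h4 : col f₄ = some i) (h5 : col f₅ = some i) (h4' : col k₄ = some i)
    (h5' : col k₅ = some i) :
    ∃ M, G.IsPM M ∧ e ∈ M ∧ G.HitsOdd col M := by
  obtain ⟨M, hM, heM, hit⟩ := exists_isPM_of_delete_edge hI ih he hj hef sx sp (hc.erase i)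
    ((eraseColour_of_eq_none h1).trans (eraseColour_of_eq_some h4).symm)
    ((eraseColour_of_eq_none h2).trans (eraseColour_of_eq_some h5).symm)
  refine ⟨M, hM, heM, hit.of_erase ?_⟩
  have hf1 : f₁ ∉ M := fun h => hef (hM.eq_of_joins heM h hj sx.f_joins.symm)
  rcases sx.mem_or_mem hM hf1 with h | h
  · have hf3 : f₃ ∉ M := fun h' => sx.g_ne_h (hM.eq_of_joins h h' sx.g_joins sx.h_joins)
    rcases sp.mem_or_mem hM hf3 with h' | h'
    exacts [⟨_, h', h4⟩, ⟨_, h', h5⟩]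
  · have hf2 : f₂ ∉ M := fun h' => sx.g_ne_h (hM.eq_of_joins h' h sx.g_joins sx.h_joins)
    rcases sq.mem_or_mem hM hf2 with h' | h'
    exacts [⟨_, h', h4'⟩, ⟨_, h', h5'⟩]

/-- The inductive step for a multigraph without non-trivial three-edge cuts. -/
theorem oddQuelling (hI : G.Irreducible)
    (ih : ∀ H : Multigraph ν ε, H.verts.card < G.verts.card → H.Cubic → H.Bridgeless →
      OddQuelling κ H) : OddQuelling κ G := by
  intro e he col hc
  by_contra hn
  set u := G.src e
  set v := G.tgt e
  have hj : G.Joins e u v := G.joins_src_tgt e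
  obtain ⟨hu, hu'⟩ := hI.untouched ih he hj hc hn
  obtain ⟨hv, -⟩ := hI.untouched ih he hj.symm hc hn
  obtain ⟨f₁, g₁, x, y, su⟩ := exists_star hI.bridgeless hI.cubic he hj
  obtain ⟨f₂, f₃, q, p, sx⟩ :=
    exists_star hI.bridgeless hI.cubic su.g_mem su.g_joins.symm
  have hef := su.f_ne_g
  obtain ⟨f₄, f₅, l, m, sp⟩ :=
    exists_star hI.bridgeless hI.cubic sx.h_mem sx.h_joins.symm
  obtain ⟨k₄, k₅, l', m', sq⟩ :=
    exists_star hI.bridgeless hI.cubic sx.g_mem sx.g_joins.symm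
  obtain ⟨h1, h2, h3⟩ := hI.eq_none_of_star ih he hj hef sx hc hn
  obtain ⟨i, h4, h5⟩ := hI.exists_eq_some_of_star ih he hj hef sx sp hc hn
  obtain ⟨j, h4', h5'⟩ := hI.exists_eq_some_of_star ih he hj hef sx.swap sq hc hn
  by_cases hij : j = i
  · subst hij
    exact hn (hI.exists_isPM_of_common_colour ih he hj hef sx sp sq hc h1 h2 h4 h5 h4' h5')
  obtain ⟨f₆, f₇, t, n, sm, h6, h7⟩ :=
    hc.exists_star_of_eq_some hI.bridgeless hI.cubic sp.h_mem sp.h_joins.symm h5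
  obtain ⟨f₉, f₈, t', r, sn, h9, h8⟩ :=
    hc.exists_star_of_eq_some hI.bridgeless hI.cubic sm.h_mem sm.h_joins.symm h7
  have hnu : ¬ G.Untouched col n := fun h => by
    have := h _ sn.f_mem _ sn.f_joins
    simp [h7] at this
  have z : G.ColouredPath col i x p m n u q l t r t' f₁ f₂ f₃ f₄ f₅ f₆ f₇ f₈ f₉ := {
    sx := sx
    sp := sp
    sm := sm
    sn := sn.swap
    c₁ := h1
    c₂ := h2
    c₃ := h3
    c₄ := h4
    c₅ := h5
    c₆ := h6
    c₇ := h7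
    c₈ := h8
    c₉ := h9
    hq := by
      intro k hk d hd
      rcases sq.eq_of_joins k hk d hd with rfl | rfl | rfl <;> simp [h2, h4', h5', hij]
    hu := by
      intro k hk d hd
      simp [hu k hk d hd]
    ut' := by
      intro hut
      have h9u : G.Joins f₉ u n := hut ▸ sn.g_joins.symm
      by_cases h9e : f₉ = e
      · have hne : n ≠ u := fun h => hnu (h ▸ hu)
        rcases hj.eq_or_eq (h9e ▸ h9u.symm) with h | h
        exacts [hne h, hnu (h ▸ hv)]
      · exact hnu (hu' f₉ sn.g_mem h9e n h9u) }
  exact hn (z.exists_isPM hI ih he hj hef (fun k hk d hd => by simp [hv k hk d hd]) hc)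

end Irreducible

/-! ### Contraction along three-edge cuts -/

/-- The multigraph obtained by contracting the complement of `X` to a single vertex, for which the
name `x₀` is used; edges inside the complement disappear. -/
def contract (G : Multigraph ν ε) (X : Finset ν) (x₀ : ν) : Multigraph ν ε where
  verts := insert x₀ X
  edges := G.edges.filter fun f => G.src f ∈ X ∨ G.tgt f ∈ X
  src f := if G.src f ∈ X then G.src f else x₀
  tgt f := if G.tgt f ∈ X then G.tgt f else x₀
  src_mem f _ := by split_ifs with h <;> simp [h]
  tgt_mem f _ := by split_ifs with h <;> simp [h]

theorem inc_contract_of_mem {x₀ : ν} (hx : x₀ ∉ X) (hw : w ∈ X) :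
    (G.contract X x₀).inc f w = G.inc f w := by
  have h0 : x₀ ≠ w := fun h => hx (h ▸ hw)
  have key : ∀ a, (if a ∈ X then a else x₀) = w ↔ a = w := by
    intro a
    split_ifs with h
    · rfl
    · exact ⟨fun h' => absurd h' h0, fun h' => absurd (h' ▸ hw) h⟩
  simp only [inc, contract, key]

theorem inc_contract_self {x₀ : ν} (hx : x₀ ∉ X) (hf : f ∈ (G.contract X x₀).edges) :
    (G.contract X x₀).inc f x₀ = G.cross X f := by
  have hf' := (Finset.mem_filter.1 hf).2
  have key : ∀ a, (if a ∈ X then a else x₀) = x₀ ↔ a ∉ X := by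
    intro a
    split_ifs with h
    · exact ⟨fun h' => absurd (h' ▸ h) hx, fun h' => absurd h h'⟩
    · simp [h]
  simp only [inc, contract, key, cross]
  by_cases h1 : G.src f ∈ X <;> by_cases h2 : G.tgt f ∈ X <;> simp_all

theorem sum_contract_eq {x₀ : ν} (φ : ε → ℕ)
    (h0 : ∀ f, G.src f ∉ X → G.tgt f ∉ X → φ f = 0) :
    ∑ f ∈ (G.contract X x₀).edges, φ f = ∑ f ∈ G.edges, φ f := by
  refine Finset.sum_subset (Finset.filter_subset _ _) fun f hf hf' => ?_
  have : ¬ (G.src f ∈ X ∨ G.tgt f ∈ X) := fun h => hf' (Finset.mem_filter.2 ⟨hf, h⟩)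
  exact h0 f (fun h => this (Or.inl h)) (fun h => this (Or.inr h))

theorem sum_inc_contract_of_mem {x₀ : ν} (hx : x₀ ∉ X) (hw : w ∈ X) (p : ε → Prop)
    [DecidablePred p] :
    ∑ f ∈ (G.contract X x₀).edges with p f, (G.contract X x₀).inc f w =
      ∑ f ∈ G.edges with p f, G.inc f w := by
  simp only [Finset.sum_filter, inc_contract_of_mem hx hw]
  refine sum_contract_eq _ fun f h1 h2 => ?_
  have n1 : G.src f ≠ w := fun h => h1 (h ▸ hw)
  have n2 : G.tgt f ≠ w := fun h => h2 (h ▸ hw)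
  simp [inc, n1, n2]

theorem sum_inc_contract_self {x₀ : ν} (hx : x₀ ∉ X) (p : ε → Prop) [DecidablePred p] :
    ∑ f ∈ (G.contract X x₀).edges with p f, (G.contract X x₀).inc f x₀ =
      ∑ f ∈ G.edges with p f, G.cross X f := by
  rw [Finset.sum_congr rfl fun f hf => inc_contract_self hx (Finset.mem_filter.1 hf).1,
    Finset.sum_filter, Finset.sum_filter]
  refine sum_contract_eq _ fun f h1 h2 => ?_
  simp [cross, h1, h2]

theorem Cubic.contract {x₀ : ν} (hG : G.Cubic) (hX : X ⊆ G.verts) (hx : x₀ ∉ X)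
    (h3 : ∑ f ∈ G.edges, G.cross X f = 3) : (G.contract X x₀).Cubic := by
  intro w hw
  rcases Finset.mem_insert.1 hw with rfl | hw
  · simpa [h3] using sum_inc_contract_self (G := G) hx fun _ => True
  · simpa [hG w (hX hw)] using sum_inc_contract_of_mem (G := G) hx hw fun _ => True

theorem EvenColouring.contract {x₀ : ν} (hc : G.EvenColouring col) (hX : X ⊆ G.verts)
    (hx : x₀ ∉ X) : (G.contract X x₀).EvenColouring col := by
  intro w hw i
  rcases Finset.mem_insert.1 hw with rfl | hw
  · rw [sum_inc_contract_self hx]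
    exact hc.even_cross hX i
  · rw [sum_inc_contract_of_mem hx hw]
    exact hc w (hX hw) i

theorem Bridgeless.contract {x₀ : ν} (hB : G.Bridgeless) : (G.contract X x₀).Bridgeless := by
  intro Y _
  -- the preimage of `Y` under the contraction
  set r : ν → ν := fun a => if a ∈ X then a else x₀ with hr
  set Z := G.verts.filter fun a => r a ∈ Y with hZ
  have hcr : ∀ f ∈ G.edges, (G.contract X x₀).cross Y f = G.cross Z f := by
    intro f hf
    simp [cross, hZ, G.src_mem f hf, G.tgt_mem f hf, Multigraph.contract, hr]
    congr!
  have h1 := hB Z (Finset.filter_subset _ _)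
  intro h
  refine h1 (Eq.trans ?_ ((Finset.sum_congr rfl fun f hf =>
    (hcr f (Finset.mem_filter.1 hf).1).symm).trans h))
  symm
  refine Finset.sum_subset (Finset.filter_subset _ _) fun f hf hf' => ?_
  have hn : ¬ (G.src f ∈ X ∨ G.tgt f ∈ X) := fun h => hf' (Finset.mem_filter.2 ⟨hf, h⟩)
  rw [not_or] at hn
  simp [cross, hZ, hr, hn.1, hn.2, G.src_mem f hf, G.tgt_mem f hf]

theorem cross_sdiff (hf : f ∈ G.edges) : G.cross (G.verts \ X) f = G.cross X f := by
  simp [cross, G.src_mem f hf, G.tgt_mem f hf, not_iff_not]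

/-- A perfect matching of a contraction along a three-edge cut has exactly one edge in the cut. -/
theorem IsPM.sum_cross_contract {x₀ : ν} (hx : x₀ ∉ X) (hM : (G.contract X x₀).IsPM M) :
    ∑ f ∈ M, G.cross X f = 1 := by
  rw [← hM.2 x₀ (Finset.mem_insert_self _ _)]
  exact Finset.sum_congr rfl fun f hf => (inc_contract_self hx (hM.1 hf)).symm

theorem IsPM.eq_of_cross {x₀ : ν} (hx : x₀ ∉ X) (hM : (G.contract X x₀).IsPM M) (hf : f ∈ M)
    (hg : g ∈ M) (h1 : G.cross X f ≠ 0) (h2 : G.cross X g ≠ 0) : f = g := by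
  by_contra hne
  have h := hM.sum_cross_contract hx
  have hsub : ({f, g} : Finset ε) ⊆ M := by
    intro k hk
    simp only [Finset.mem_insert, Finset.mem_singleton] at hk
    rcases hk with rfl | rfl <;> assumption
  have h' := Finset.sum_le_sum_of_subset (f := fun k => G.cross X k) hsub
  rw [Finset.sum_pair hne] at h'
  omega

/-- Two perfect matchings of the contractions along a three-edge cut, which contain the same edge
`c` of the cut, fit together: this is the covering condition on one side. -/
theorem sum_inc_union_eq_one {x₀ y₀ : ν} {M₁ M₂ : Finset ε} (hx : x₀ ∉ X)
    (hy : y₀ ∉ G.verts \ X) (h₁ : (G.contract X x₀).IsPM M₁)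
    (h₂ : (G.contract (G.verts \ X) y₀).IsPM M₂) {k : ε} (hk₁ : k ∈ M₁) (hk₂ : k ∈ M₂)
    (hk : G.cross X k ≠ 0) (hw : w ∈ X) : ∑ f ∈ M₁ ∪ M₂, G.inc f w = 1 := by
  rw [← h₁.2 w (Finset.mem_insert_of_mem hw),
    Finset.sum_congr rfl fun f _ => inc_contract_of_mem hx hw]
  symm
  refine Finset.sum_subset Finset.subset_union_left fun f hf hf1 => ?_
  have hf2 : f ∈ M₂ := (Finset.mem_union.1 hf).resolve_left hf1
  obtain ⟨hfe, hor⟩ := Finset.mem_filter.1 (h₂.1 hf2)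
  have hke : k ∈ G.edges := (Finset.mem_filter.1 (h₁.1 hk₁)).1
  by_contra h0
  obtain ⟨d, hd⟩ := inc_ne_zero_iff.1 h0
  have hfk : f = k := by
    refine h₂.eq_of_cross hy hf2 hk₂ ?_ (by rwa [cross_sdiff hke])
    rw [cross_sdiff hfe, hd.cross_eq]
    have hdX : d ∉ X := by
      simp only [Finset.mem_sdiff] at hor
      rcases hd with ⟨h, h'⟩ | ⟨h, h'⟩ <;> subst h <;> subst h' <;> tauto
    simp [hw, hdX]
  exact hf1 (hfk ▸ hk₁)

/-- The two parts of a colour class obtained by contracting along an edge cut. -/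
theorem card_contract_add_card_contract (x₀ y₀ : ν) (i : κ) :
    ((G.contract X x₀).edges.filter fun f => col f = some i).card +
      ((G.contract (G.verts \ X) y₀).edges.filter fun f => col f = some i).card =
    (G.edges.filter fun f => col f = some i).card +
      ∑ f ∈ G.edges with col f = some i, G.cross X f := by
  simp only [Finset.card_filter, Finset.sum_filter, contract]
  rw [← Finset.sum_add_distrib, ← Finset.sum_add_distrib]
  refine Finset.sum_congr rfl fun f hf => ?_
  have h1 := G.src_mem f hf
  have h2 := G.tgt_mem f hf
  by_cases hc : col f = some i <;> by_cases hs : G.src f ∈ X <;> by_cases ht : G.tgt f ∈ X <;>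
    simp [hc, hs, ht, h1, h2, cross]

/-- Contraction of both sides of a three-edge cut, where the edge `e` has an end in `X`. -/
theorem exists_isPM_of_contract
    (ih : ∀ H : Multigraph ν ε, H.verts.card < G.verts.card → H.Cubic → H.Bridgeless →
      OddQuelling κ H) (hG : G.Cubic) (hB : G.Bridgeless) (hX : X ⊆ G.verts)
    (h3 : ∑ f ∈ G.edges, G.cross X f = 3) (h1 : 1 < X.card) (h2 : 1 < (G.verts \ X).card)
    (he : e ∈ G.edges) (heX : G.src e ∈ X ∨ G.tgt e ∈ X) (hc : G.EvenColouring col) :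
    ∃ M, G.IsPM M ∧ e ∈ M ∧ G.HitsOdd col M := by
  obtain ⟨y₀, hy₀⟩ := Finset.card_pos.1 (zero_lt_one.trans h1)
  obtain ⟨x₀, hx₀⟩ := Finset.card_pos.1 (zero_lt_one.trans h2)
  have hx : x₀ ∉ X := (Finset.mem_sdiff.1 hx₀).2
  have hy : y₀ ∉ G.verts \ X := fun h => (Finset.mem_sdiff.1 h).2 hy₀
  have hXX : G.verts \ (G.verts \ X) = X := Finset.sdiff_sdiff_eq_self hX
  have hcard := Finset.card_sdiff_add_card_eq_card hX
  have h3' : ∑ f ∈ G.edges, G.cross (G.verts \ X) f = 3 := by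
    rw [Finset.sum_congr rfl fun f hf => cross_sdiff hf, h3]
  obtain ⟨M₁, hM₁, heM, hit₁⟩ := ih (G.contract X x₀)
    (show (insert x₀ X).card < _ by rw [Finset.card_insert_of_notMem hx]; omega)
    (hG.contract hX hx h3) hB.contract e (Finset.mem_filter.2 ⟨he, heX⟩) col (hc.contract hX hx)
  obtain ⟨k, hk₁, hk⟩ : ∃ k ∈ M₁, G.cross X k ≠ 0 :=
    Finset.exists_ne_zero_of_sum_ne_zero (by rw [hM₁.sum_cross_contract hx]; exact one_ne_zero)
  have hke : k ∈ G.edges := (Finset.mem_filter.1 (hM₁.1 hk₁)).1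
  have hkX : G.src k ∈ G.verts \ X ∨ G.tgt k ∈ G.verts \ X := by
    simp only [Finset.mem_sdiff, G.src_mem k hke, G.tgt_mem k hke, true_and]
    by_contra! h
    simp [cross, h.1, h.2] at hk
  obtain ⟨M₂, hM₂, hk₂, hit₂⟩ := ih (G.contract (G.verts \ X) y₀)
    (show (insert y₀ (G.verts \ X)).card < _ by rw [Finset.card_insert_of_notMem hy]; omega)
    (hG.contract Finset.sdiff_subset hy h3') hB.contract k (Finset.mem_filter.2 ⟨hke, hkX⟩) col
    (hc.contract Finset.sdiff_subset hy)
  refine ⟨M₁ ∪ M₂, ⟨?_, fun w hw => ?_⟩, Finset.mem_union_left _ heM, fun i hi => ?_⟩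
  · intro f hf
    rcases Finset.mem_union.1 hf with h | h
    exacts [(Finset.mem_filter.1 (hM₁.1 h)).1, (Finset.mem_filter.1 (hM₂.1 h)).1]
  · by_cases hwX : w ∈ X
    · exact sum_inc_union_eq_one hx hy hM₁ hM₂ hk₁ hk₂ hk hwX
    · rw [Finset.union_comm]
      refine sum_inc_union_eq_one hy (x₀ := y₀) (y₀ := x₀) (by rwa [hXX]) hM₂
        (by rwa [hXX]) hk₂ hk₁ (by rwa [cross_sdiff hke]) (Finset.mem_sdiff.2 ⟨hw, hwX⟩)
  · have hodd : Odd (((G.contract X x₀).edges.filter fun f => col f = some i).card +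
        ((G.contract (G.verts \ X) y₀).edges.filter fun f => col f = some i).card) := by
      rw [card_contract_add_card_contract]
      exact hi.add_even (hc.even_cross hX i)
    rcases Nat.even_or_odd ((G.contract X x₀).edges.filter fun f => col f = some i).card with h | h
    · obtain ⟨f, hf, hfi⟩ := hit₂ i ((Nat.odd_add'.1 hodd).2 h)
      exact ⟨f, Finset.mem_union_right _ hf, hfi⟩
    · obtain ⟨f, hf, hfi⟩ := hit₁ i h
      exact ⟨f, Finset.mem_union_left _ hf, hfi⟩

theorem oddQuelling_of_not_trivial
    (ih : ∀ H : Multigraph ν ε, H.verts.card < G.verts.card → H.Cubic → H.Bridgeless →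
      OddQuelling κ H) (hG : G.Cubic) (hB : G.Bridgeless) (hn : ¬ G.OnlyTrivialThreeCuts) :
    OddQuelling κ G := by
  intro e he col hc
  simp only [OnlyTrivialThreeCuts, not_forall, not_or, not_le] at hn
  obtain ⟨X, hX, h3, h1, h2⟩ := hn
  by_cases heX : G.src e ∈ X ∨ G.tgt e ∈ X
  · exact exists_isPM_of_contract ih hG hB hX h3 h1 h2 he heX hc
  · refine exists_isPM_of_contract ih hG hB (X := G.verts \ X) Finset.sdiff_subset ?_ h2 ?_ he ?_ hc
    · rw [Finset.sum_congr rfl fun f hf => cross_sdiff hf, h3]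
    · rwa [Finset.sdiff_sdiff_eq_self hX]
    · exact Or.inl (Finset.mem_sdiff.2 ⟨G.src_mem e he, fun h => heX (Or.inl h)⟩)

/-! ### Few vertices, and the induction -/

theorem oddQuelling_of_verts_eq_pair {u v : ν} (hG : G.Cubic) (hB : G.Bridgeless)
    (he : e ∈ G.edges) (hj : G.Joins e u v) (hV : G.verts = {u, v}) (hc : G.EvenColouring col) :
    ∃ M, G.IsPM M ∧ e ∈ M ∧ G.HitsOdd col M := by
  have huv := hB.ne_of_joins hG he hj
  refine ⟨{e}, ⟨by simpa using he, fun w hw => ?_⟩, by simp, fun i hi => ?_⟩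
  · rw [Finset.sum_singleton, hj.inc_eq]
    rw [hV, Finset.mem_insert, Finset.mem_singleton] at hw
    rcases hw with rfl | rfl
    · simp [huv.symm]
    · simp [huv]
  · have h := hc u (hj.left_mem he) i
    rw [Finset.sum_congr rfl (g := fun _ => 1), ← Finset.card_eq_sum_ones] at h
    · exact absurd h (Nat.not_even_iff_odd.2 hi)
    · intro f hf
      have hfe := (Finset.mem_filter.1 hf).1
      have h1 := G.src_mem f hfe
      have h2 := G.tgt_mem f hfe
      have hne := hB.ne_of_joins hG hfe (G.joins_src_tgt f)
      rw [hV, Finset.mem_insert, Finset.mem_singleton] at h1 h2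
      rcases h1 with h1 | h1 <;> rcases h2 with h2 | h2 <;>
        simp_all [inc, huv.symm]

/-- With four vertices, the matching consists of `e` and an edge joining the other two vertices.
An odd colour class avoiding both would need more edges between the two pairs than there are. -/
theorem oddQuelling_of_verts_eq_four {u v y z : ν} (hG : G.Cubic) (hB : G.Bridgeless)
    (he : e ∈ G.edges) (hj : G.Joins e u v) (hV : G.verts = {u, v, y, z})
    (hd : [u, v, y, z].Nodup) (hc : G.EvenColouring col) :
    ∃ M, G.IsPM M ∧ e ∈ M ∧ G.HitsOdd col M := by
  have huv : u ≠ v := by rintro rfl; simp at hd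
  have huy : u ≠ y := by rintro rfl; simp at hd
  have huz : u ≠ z := by rintro rfl; simp at hd
  have hvy : v ≠ y := by rintro rfl; simp at hd
  have hvz : v ≠ z := by rintro rfl; simp at hd
  have hyz : y ≠ z := by rintro rfl; simp at hd
  set S : ε → ℕ := fun f => G.inc f u * G.inc f v with hS
  set T : ε → ℕ := fun f => G.inc f y * G.inc f z with hT
  set cu : ε → ℕ := fun f => G.inc f u * (G.inc f y + G.inc f z) with hcu
  set cv : ε → ℕ := fun f => G.inc f v * (G.inc f y + G.inc f z) with hcv
  set cy : ε → ℕ := fun f => G.inc f y * (G.inc f u + G.inc f v) with hcy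
  set cz : ε → ℕ := fun f => G.inc f z * (G.inc f u + G.inc f v) with hcz
  have key : ∀ f ∈ G.edges, G.inc f u = S f + cu f ∧ G.inc f v = S f + cv f ∧
      G.inc f y = T f + cy f ∧ G.inc f z = T f + cz f ∧ cu f + cv f = cy f + cz f ∧
      1 = S f + T f + (cu f + cv f) := by
    intro f hf
    have h1 := G.src_mem f hf
    have h2 := G.tgt_mem f hf
    have hne := hB.ne_of_joins hG hf (G.joins_src_tgt f)
    simp only [hV, Finset.mem_insert, Finset.mem_singleton] at h1 h2
    simp only [hS, hT, hcu, hcv, hcy, hcz, inc]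
    rcases h1 with h1 | h1 | h1 | h1 <;> rcases h2 with h2 | h2 | h2 | h2 <;>
      first
      | exact absurd (h1.trans h2.symm) hne
      | simp [h1, h2, huv, huy, huz, hvy, hvz, hyz, huv.symm, huy.symm, huz.symm, hvy.symm,
          hvz.symm, hyz.symm]
  have sums : ∀ A ⊆ G.edges, ∑ f ∈ A, G.inc f u = ∑ f ∈ A, S f + ∑ f ∈ A, cu f ∧
      ∑ f ∈ A, G.inc f v = ∑ f ∈ A, S f + ∑ f ∈ A, cv f ∧
      ∑ f ∈ A, G.inc f y = ∑ f ∈ A, T f + ∑ f ∈ A, cy f ∧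
      ∑ f ∈ A, G.inc f z = ∑ f ∈ A, T f + ∑ f ∈ A, cz f ∧
      ∑ f ∈ A, cu f + ∑ f ∈ A, cv f = ∑ f ∈ A, cy f + ∑ f ∈ A, cz f ∧
      A.card = ∑ f ∈ A, S f + ∑ f ∈ A, T f + (∑ f ∈ A, cu f + ∑ f ∈ A, cv f) := by
    intro A hA
    simp only [Finset.card_eq_sum_ones, ← Finset.sum_add_distrib]
    exact ⟨Finset.sum_congr rfl fun f hf => (key f (hA hf)).1,
      Finset.sum_congr rfl fun f hf => (key f (hA hf)).2.1,
      Finset.sum_congr rfl fun f hf => (key f (hA hf)).2.2.1,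
      Finset.sum_congr rfl fun f hf => (key f (hA hf)).2.2.2.1,
      Finset.sum_congr rfl fun f hf => (key f (hA hf)).2.2.2.2.1,
      Finset.sum_congr rfl fun f hf => (key f (hA hf)).2.2.2.2.2⟩
  obtain ⟨t1, t2, t3, t4, t5, -⟩ := sums _ subset_rfl
  rw [hG u (by simp [hV])] at t1
  rw [hG v (by simp [hV])] at t2
  rw [hG y (by simp [hV])] at t3
  rw [hG z (by simp [hV])] at t4
  have hSe : 0 < S e := by simp [hS, hj.inc_eq]
  have hS0 : 0 < ∑ f ∈ G.edges, S f :=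
    hSe.trans_le (Finset.single_le_sum (fun f _ => Nat.zero_le (S f)) he)
  obtain ⟨f, hf, hTf⟩ : ∃ f ∈ G.edges, T f ≠ 0 :=
    Finset.exists_ne_zero_of_sum_ne_zero (by omega)
  have hfj : G.Joins f y z := by
    simp only [hT, ne_eq, mul_eq_zero, not_or] at hTf
    obtain ⟨b, hb⟩ := inc_ne_zero_iff.1 hTf.1
    obtain ⟨b', hb'⟩ := inc_ne_zero_iff.1 hTf.2
    rcases hb.eq_or_eq hb' with h | h
    · exact absurd h.symm hyz
    · exact h ▸ hb
  have hef : e ≠ f := by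
    rintro rfl
    rcases hj.eq_or_eq hfj with h | h
    exacts [huy h.symm, hvy h.symm]
  refine ⟨{e, f}, ⟨?_, fun w hw => ?_⟩, by simp, fun i hi => ?_⟩
  · intro k hk
    simp only [Finset.mem_insert, Finset.mem_singleton] at hk
    rcases hk with rfl | rfl <;> assumption
  · rw [Finset.sum_pair hef, hj.inc_eq, hfj.inc_eq]
    simp only [hV, Finset.mem_insert, Finset.mem_singleton] at hw
    rcases hw with rfl | rfl | rfl | rfl <;>
      simp [huv, huy, huz, hvy, hvz, hyz, huv.symm, huy.symm, huz.symm, hvy.symm, hvz.symm,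
        hyz.symm]
  · by_contra! hno
    set A := G.edges.filter fun f => col f = some i with hA
    have hsub : A ⊆ G.edges := Finset.filter_subset _ _
    obtain ⟨a1, a2, a3, a4, a5, a6⟩ := sums A hsub
    have hu := hc u (by simp [hV]) i
    have hv := hc v (by simp [hV]) i
    have hy := hc y (by simp [hV]) i
    have hz := hc z (by simp [hV]) i
    rw [← hA, a1] at hu
    rw [← hA, a2] at hv
    rw [← hA, a3] at hy
    rw [← hA, a4] at hz
    have heA : e ∉ A := fun h => hno e (by simp) (Finset.mem_filter.1 h).2
    have hfA : f ∉ A := fun h => hno f (by simp) (Finset.mem_filter.1 h).2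
    have l1 : ∑ f ∈ A, S f < ∑ f ∈ G.edges, S f :=
      Finset.sum_lt_sum_of_subset hsub he heA hSe fun _ _ _ => Nat.zero_le _
    have l2 : ∑ f ∈ A, T f < ∑ f ∈ G.edges, T f :=
      Finset.sum_lt_sum_of_subset hsub hf hfA (Nat.pos_of_ne_zero hTf) fun _ _ _ => Nat.zero_le _
    have c1 := Finset.sum_le_sum_of_subset (f := cu) hsub
    have c2 := Finset.sum_le_sum_of_subset (f := cv) hsub
    have c3 := Finset.sum_le_sum_of_subset (f := cy) hsub
    have c4 := Finset.sum_le_sum_of_subset (f := cz) hsub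
    rw [a6] at hi
    rw [Nat.even_iff] at hu hv hy hz
    rw [Nat.odd_iff] at hi
    omega

theorem oddQuelling_of_card_lt_five (hG : G.Cubic) (hB : G.Bridgeless)
    (hV : G.verts.card < 5) : OddQuelling κ G := by
  intro e he col hc
  have hj := G.joins_src_tgt e
  have huv := hB.ne_of_joins hG he hj
  have hu := hj.left_mem he
  have hv := hj.right_mem he
  set u := G.src e
  set v := G.tgt e
  have h2 : ((G.verts.erase u).erase v).card = G.verts.card - 2 := by
    rw [Finset.card_erase_of_mem (Finset.mem_erase.2 ⟨huv.symm, hv⟩), Finset.card_erase_of_mem hu]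
    omega
  have hV' : G.verts = insert u (insert v ((G.verts.erase u).erase v)) := by
    rw [Finset.insert_erase (Finset.mem_erase.2 ⟨huv.symm, hv⟩), Finset.insert_erase hu]
  have hpos : 2 ≤ G.verts.card := (Finset.card_pair huv).ge.trans (Finset.card_le_card (by
    intro w hw
    simp only [Finset.mem_insert, Finset.mem_singleton] at hw
    rcases hw with rfl | rfl <;> assumption))
  have hpar := hG.three_mul_card subset_rfl
  have h0 : ∑ f ∈ G.edges, G.cross G.verts f = 0 :=
    Finset.sum_eq_zero fun f hf => by simp [cross, G.src_mem f hf, G.tgt_mem f hf]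
  obtain h | h : G.verts.card - 2 = 0 ∨ G.verts.card - 2 = 2 := by omega
  · rw [h, Finset.card_eq_zero] at h2
    rw [h2] at hV'
    exact oddQuelling_of_verts_eq_pair hG hB he hj hV' hc
  · rw [h, Finset.card_eq_two] at h2
    obtain ⟨y, z, hyz, hyz'⟩ := h2
    have hy : y ∈ (G.verts.erase u).erase v := by simp [hyz']
    have hz : z ∈ (G.verts.erase u).erase v := by simp [hyz']
    simp only [Finset.mem_erase] at hy hz
    rw [hyz'] at hV'
    refine oddQuelling_of_verts_eq_four hG hB he hj hV' ?_ hc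
    simp [huv, hy.1.symm, hy.2.1.symm, hz.1.symm, hz.2.1.symm, hyz]

/-- In a cubic bridgeless multigraph, some perfect matching through a prescribed edge meets all
odd classes of an even colouring. -/
theorem oddQuelling (G : Multigraph ν ε) (hG : G.Cubic) (hB : G.Bridgeless) :
    OddQuelling κ G := by
  induction hn : G.verts.card using Nat.strong_induction_on generalizing G with
  | _ n ih =>
    subst hn
    have ih' : ∀ H : Multigraph ν ε, H.verts.card < G.verts.card → H.Cubic → H.Bridgeless →
        OddQuelling κ H := fun H hlt hH hHB => ih _ hlt H hH hHB rfl
    by_cases h5 : G.verts.card < 5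
    · exact oddQuelling_of_card_lt_five hG hB h5
    by_cases ht : G.OnlyTrivialThreeCuts
    · exact Irreducible.oddQuelling ⟨hG, hB, ht, not_lt.1 h5⟩ ih'
    · exact oddQuelling_of_not_trivial ih' hG hB ht

end Multigraph

/-! ### Odd closed walks -/

namespace SimpleGraph

variable {V : Type*} {G : SimpleGraph V}

namespace Walk

variable {u v : V}

/-- A walk can be shortened to a path by cutting out cycles; the parity of its length only changes
if one of these cycles is odd. -/
theorem exists_isPath_or_exists_odd_isCycle (p : G.Walk u v) :
    (∃ q : G.Walk u v, q.IsPath ∧ q.edges ⊆ p.edges ∧ (Odd q.length ↔ Odd p.length)) ∨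
      ∃ (w : V) (c : G.Walk w w), c.IsCycle ∧ Odd c.length ∧ c.edges ⊆ p.edges := by
  classical
  induction p with
  | nil => exact Or.inl ⟨nil, IsPath.nil, by simp, by simp⟩
  | @cons u x v hadj p ih =>
    rcases ih with ⟨q, hq, hsub, hodd⟩ | ⟨w, c, hc, hodd, hsub⟩
    swap
    · exact Or.inr ⟨w, c, hc, hodd, fun e he => by simp [hsub he]⟩
    by_cases hu : u ∈ q.support
    · have hlen : (q.takeUntil u hu).length + (q.dropUntil u hu).length = q.length := by
        rw [← length_append, take_spec]
      by_cases h1 : Odd (q.takeUntil u hu).length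
      · refine Or.inl ⟨q.dropUntil u hu, hq.dropUntil hu, fun e he => ?_, ?_⟩
        · simp [hsub (q.edges_dropUntil_subset_edges hu he)]
        · rw [length_cons, Nat.odd_add_one, ← hodd, ← hlen, Nat.odd_add]
          simp [h1]
      · refine Or.inr ⟨u, cons hadj (q.takeUntil u hu), ?_, ?_, ?_⟩
        · refine (cons_isCycle_iff _ hadj).2 ⟨hq.takeUntil hu, fun hmem => h1 ?_⟩
          rw [Sym2.eq_swap] at hmem
          rw [(hq.takeUntil hu).length_eq_one_of_mem_edges hmem]
          exact odd_one
        · rw [length_cons, Nat.odd_add_one]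
          exact h1
        · intro e he
          rw [edges_cons, List.mem_cons] at he ⊢
          exact he.imp_right fun h => hsub (q.edges_takeUntil_subset_edges hu h)
    · refine Or.inl ⟨cons hadj q, hq.cons hu, ?_, ?_⟩
      · intro e he
        rw [edges_cons, List.mem_cons] at he ⊢
        exact he.imp_right fun h => hsub h
      · rw [length_cons, length_cons, Nat.odd_add_one, Nat.odd_add_one, hodd]

theorem exists_odd_isCycle (p : G.Walk u u) (hp : Odd p.length) :
    ∃ (w : V) (c : G.Walk w w), c.IsCycle ∧ Odd c.length ∧ c.edges ⊆ p.edges := by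
  rcases p.exists_isPath_or_exists_odd_isCycle with ⟨q, hq, -, hodd⟩ | h
  · rw [(isPath_iff_nil.1 hq).length_eq_zero] at hodd
    exact absurd (hodd.2 hp) Nat.not_odd_zero
  · exact h

end Walk

/-! ### Simple graphs as multigraphs -/

section toMultigraph

variable [Fintype V] [Fintype G.edgeSet]

variable (G) in
/-- A finite simple graph as a multigraph, with the elements of `Sym2 V` as names of the edges. -/
noncomputable def toMultigraph : Multigraph V (Sym2 V) where
  verts := Finset.univ
  edges := G.edgeFinset
  src f := f.out.1
  tgt f := f.out.2
  src_mem _ _ := Finset.mem_univ _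
  tgt_mem _ _ := Finset.mem_univ _

theorem mem_toMultigraph_edges {f : Sym2 V} : f ∈ G.toMultigraph.edges ↔ f ∈ G.edgeSet :=
  mem_edgeFinset

theorem toMultigraph_joins_iff {f : Sym2 V} {a b : V} :
    G.toMultigraph.Joins f a b ↔ f = s(a, b) := by
  have h : f = s(f.out.1, f.out.2) := by rw [Sym2.mk, f.out_eq]
  constructor
  · intro hj
    rw [h]
    exact Sym2.eq_iff.2 hj
  · intro hf
    exact Sym2.eq_iff.1 (h.symm.trans hf)

variable [DecidableEq V]

theorem toMultigraph_inc {f : Sym2 V} (hf : f ∈ G.edgeSet) (w : V) :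
    G.toMultigraph.inc f w = if w ∈ f then 1 else 0 := by
  induction f with
  | _ a b =>
    have hne : a ≠ b := G.ne_of_adj hf
    rw [(toMultigraph_joins_iff.2 rfl).inc_eq]
    by_cases h1 : a = w
    · subst h1
      simp [hne.symm]
    · by_cases h2 : b = w <;> simp [h1, h2, @eq_comm _ w]

theorem toMultigraph_cubic [DecidableRel G.Adj] (hG : G.IsRegularOfDegree 3) :
    G.toMultigraph.Cubic := by
  intro w _
  rw [← hG w, ← card_incidenceFinset_eq_degree,
    Finset.sum_congr rfl fun f hf => toMultigraph_inc (mem_toMultigraph_edges.1 hf) w,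
    ← Finset.card_filter]
  congr 1
  ext e
  simp [toMultigraph, incidenceSet]

theorem toMultigraph_bridgeless (hG : ∀ e ∈ G.edgeSet, ¬ G.IsBridge e) :
    G.toMultigraph.Bridgeless := by
  intro X _ h1
  obtain ⟨f, hf, hf0⟩ := Finset.exists_ne_zero_of_sum_ne_zero (h1.trans_ne one_ne_zero)
  have huniq : ∀ g ∈ G.edgeFinset, G.toMultigraph.cross X g ≠ 0 → g = f := by
    intro g hg hg0
    by_contra hne
    have hsub : ({g, f} : Finset (Sym2 V)) ⊆ G.toMultigraph.edges := by
      intro k hk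
      simp only [Finset.mem_insert, Finset.mem_singleton] at hk
      rcases hk with rfl | rfl <;> assumption
    have h := Finset.sum_le_sum_of_subset (f := fun k => G.toMultigraph.cross X k) hsub
    rw [Finset.sum_pair hne] at h
    omega
  have hfG : f ∈ G.edgeSet := mem_edgeFinset.1 hf
  refine hG f hfG ?_
  induction f with
  | _ a b =>
    rw [(toMultigraph_joins_iff.2 rfl).cross_eq] at hf0
    rw [isBridge_iff]
    rintro ⟨p⟩
    have key : ∀ {c d : V} (_ : (G.deleteEdges {s(a, b)}).Walk c d), (c ∈ X ↔ d ∈ X) := by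
      intro c d p
      induction p with
      | nil => rfl
      | @cons c d d' hadj p ih =>
        refine Iff.trans ?_ ih
        rw [deleteEdges_adj] at hadj
        by_contra hcd
        refine hadj.2 (huniq s(c, d) (mem_edgeFinset.2 hadj.1) ?_)
        rw [(toMultigraph_joins_iff.2 rfl).cross_eq]
        simp [hcd]
    exact hf0 (if_pos (key p))

end toMultigraph

/-! ### Families of odd cycles -/

theorem Subgraph.ncard_neighborSet_eq {H : G.Subgraph} (w : V) :
    {e ∈ H.edgeSet | w ∈ e}.ncard = (H.neighborSet w).ncard := by
  have h : {e ∈ H.edgeSet | w ∈ e} = (fun x => s(w, x)) '' H.neighborSet w := by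
    ext e
    constructor
    · rintro ⟨he, x, rfl⟩
      exact ⟨x, he, rfl⟩
    · rintro ⟨x, hx, rfl⟩
      exact ⟨hx, Sym2.mem_mk_left _ _⟩
  rw [h]
  exact Set.ncard_image_of_injective _ fun x y hxy => Sym2.congr_right.1 hxy

theorem Subgraph.IsOddCycle.ncard_neighborSet {C : G.Subgraph} (hC : C.IsOddCycle) {w : V}
    (hw : w ∈ C.verts) : (C.neighborSet w).ncard = 2 := by
  obtain ⟨v, p, hp, -, rfl⟩ := hC
  exact hp.ncard_neighborSet_toSubgraph_eq_two (p.mem_verts_toSubgraph.1 hw)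

theorem Subgraph.IsOddCycle.even_ncard_neighborSet {C : G.Subgraph} (hC : C.IsOddCycle) (w : V) :
    Even (C.neighborSet w).ncard := by
  by_cases hw : w ∈ C.verts
  · rw [hC.ncard_neighborSet hw]
    exact even_two
  · have : C.neighborSet w = ∅ := Set.eq_empty_of_forall_notMem fun x hx => hw (C.edge_vert hx)
    simp [this]

theorem Subgraph.IsOddCycle.odd_ncard_edgeSet {C : G.Subgraph} (hC : C.IsOddCycle) :
    Odd C.edgeSet.ncard := by
  classical
  obtain ⟨v, p, hp, hodd, rfl⟩ := hC
  have h : p.toSubgraph.edgeSet = (p.edges.toFinset : Set (Sym2 V)) := by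
    ext e
    rw [Walk.mem_edges_toSubgraph]
    simp
  rwa [h, Set.ncard_coe_finset, List.toFinset_card_of_nodup hp.edges_nodup, Walk.length_edges]

/-- The spanning subgraph with the edge set `M`. -/
def subgraphOfEdges (M : Set (Sym2 V)) (hM : M ⊆ G.edgeSet) : G.Subgraph where
  verts := Set.univ
  Adj a b := s(a, b) ∈ M
  adj_sub h := hM h
  edge_vert _ := Set.mem_univ _
  symm := ⟨fun a b (h : s(a, b) ∈ M) => by rwa [Sym2.eq_swap]⟩

/-- In a cubic bridgeless graph, one perfect matching meets all members of any family of
edge-disjoint odd cycles. -/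
theorem exists_isPerfectMatching_meeting_odd_cycles [Fintype V] [DecidableRel G.Adj]
    (hcubic : G.IsRegularOfDegree 3) (hbridgeless : ∀ e ∈ G.edgeSet, ¬ G.IsBridge e)
    (𝒞 : Set G.Subgraph) (hodd : ∀ C ∈ 𝒞, C.IsOddCycle)
    (hdisj : ∀ C ∈ 𝒞, ∀ D ∈ 𝒞, C ≠ D → Disjoint C.edgeSet D.edgeSet) :
    ∃ M : G.Subgraph, M.IsPerfectMatching ∧ ∀ C ∈ 𝒞, (C.edgeSet ∩ M.edgeSet).Nonempty := by
  classical
  rcases isEmpty_or_nonempty V with hV | ⟨⟨a⟩⟩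
  · refine ⟨⊥, Subgraph.isPerfectMatching_iff.2 fun v => hV.elim v, fun C hC => ?_⟩
    obtain ⟨v, -⟩ := hodd C hC
    exact hV.elim v
  obtain ⟨b, hab⟩ : ∃ b, G.Adj a b := by
    rw [← degree_pos_iff_exists_adj, hcubic a]
    norm_num
  -- an edge is coloured by the member of the family that contains it
  set col : Sym2 V → Option G.Subgraph := fun f =>
    if h : ∃ C ∈ 𝒞, f ∈ C.edgeSet then some h.choose else none with hcol
  have hcol_iff : ∀ f C, col f = some C ↔ C ∈ 𝒞 ∧ f ∈ C.edgeSet := by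
    intro f C
    by_cases h : ∃ C ∈ 𝒞, f ∈ C.edgeSet
    · simp only [hcol, dif_pos h, Option.some.injEq]
      constructor
      · rintro rfl
        exact h.choose_spec
      · rintro ⟨hC, hf⟩
        by_contra hne
        exact Set.disjoint_left.1 (hdisj _ h.choose_spec.1 C hC hne) h.choose_spec.2 hf
    · simp only [hcol, dif_neg h, reduceCtorEq, false_iff]
      exact fun h' => h ⟨C, h'⟩
  have hclass : ∀ C ∈ 𝒞,
      ((G.toMultigraph.edges.filter fun f => col f = some C : Finset _) : Set (Sym2 V)) =
        C.edgeSet := by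
    intro C hC
    ext f
    simp only [Finset.coe_filter, Set.mem_ofPred_eq, hcol_iff, hC, true_and]
    exact ⟨fun h => h.2, fun h => ⟨mem_edgeFinset.2 (C.edgeSet_subset h), h⟩⟩
  have heven : G.toMultigraph.EvenColouring col := by
    intro w _ C
    by_cases hC : C ∈ 𝒞
    · rw [Finset.sum_congr rfl fun f hf =>
        toMultigraph_inc (mem_toMultigraph_edges.1 (Finset.mem_filter.1 hf).1) w,
        ← Finset.card_filter, ← Set.ncard_coe_finset, Finset.coe_filter]
      simp only [← Finset.mem_coe, hclass C hC]
      rw [Subgraph.ncard_neighborSet_eq]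
      exact (hodd C hC).even_ncard_neighborSet w
    · simp [hcol_iff, hC]
  obtain ⟨M, hM, -, hit⟩ := Multigraph.oddQuelling G.toMultigraph (toMultigraph_cubic hcubic)
    (toMultigraph_bridgeless hbridgeless) s(a, b) (mem_edgeFinset.2 hab) col heven
  refine ⟨subgraphOfEdges (M : Set (Sym2 V)) fun f hf => mem_edgeFinset.1 (hM.1 hf),
    Subgraph.isPerfectMatching_iff.2 fun v => ?_, fun C hC => ?_⟩
  · obtain ⟨f, hf, w, hfw⟩ := hM.exists_joins (w := v) (Finset.mem_univ _)
    refine ⟨w, ?_, fun w' hw' => ?_⟩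
    · rw [toMultigraph_joins_iff] at hfw
      rwa [hfw] at hf
    · have h := hM.eq_of_joins hf hw' hfw (toMultigraph_joins_iff.2 rfl)
      rw [toMultigraph_joins_iff.1 hfw] at h
      exact (Sym2.congr_right.1 h).symm
  · obtain ⟨f, hf, hfC⟩ := hit C (by
      rw [← Set.ncard_coe_finset, hclass C hC]
      exact (hodd C hC).odd_ncard_edgeSet)
    refine ⟨f, ((hcol_iff f C).1 hfC).2, ?_⟩
    induction f with
    | _ x y => exact hf

/-! ### Odd cycles in 2-factors -/

/-- The edges outside the subgraph `F`, as a spanning subgraph. -/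
def Subgraph.edgeComplement (F : G.Subgraph) : G.Subgraph where
  verts := Set.univ
  Adj a b := G.Adj a b ∧ ¬ F.Adj a b
  adj_sub h := h.1
  edge_vert _ := Set.mem_univ _
  symm := ⟨fun _ _ h => ⟨h.1.symm, fun h' => h.2 h'.symm⟩⟩

theorem Subgraph.IsTwoFactor.isPerfectMatching_edgeComplement [Fintype V] [DecidableRel G.Adj]
    (hcubic : G.IsRegularOfDegree 3) {F : G.Subgraph} (hF : F.IsTwoFactor) :
    F.edgeComplement.IsPerfectMatching := by
  rw [Subgraph.isPerfectMatching_iff]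
  intro v
  have h3 : (G.neighborSet v).ncard = 3 := by
    rw [← hcubic v, ← card_neighborSet_eq_degree, Set.ncard_eq_toFinset_card', Set.toFinset_card]
  have h1 : (G.neighborSet v \ F.neighborSet v).ncard = 1 := by
    rw [Set.ncard_sdiff (F.neighborSet_subset v), h3, hF.2 v]
  obtain ⟨w, hw⟩ := Set.ncard_eq_one.1 h1
  have hmem : ∀ x, F.edgeComplement.Adj v x ↔ x = w := fun x => by
    rw [← Set.mem_singleton_iff, ← hw]
    rfl
  exact ⟨w, (hmem w).2 rfl, fun x hx => (hmem x).1 hx⟩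

/-- A cycle in a 2-factor has all edges of the 2-factor at each of its vertices. -/
theorem Subgraph.IsTwoFactor.adj_iff [Finite V] {F C : G.Subgraph} (hF : F.IsTwoFactor)
    (hC : C.IsOddCycle) (hCF : C ≤ F) {v w : V} (hv : v ∈ C.verts) : C.Adj v w ↔ F.Adj v w := by
  have h : C.neighborSet v = F.neighborSet v :=
    Set.eq_of_subset_of_ncard_le (fun _ hx => hCF.2 hx)
      (by rw [hF.2 v, hC.ncard_neighborSet hv]) (Set.toFinite _)
  exact Set.ext_iff.1 h w

/-- An odd cycle in a 2-factor is traversed by a walk that cannot leave another odd cycle, once it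
shares a vertex with it. -/
theorem Subgraph.IsTwoFactor.le_of_mem_verts [Finite V] {F C D : G.Subgraph} (hF : F.IsTwoFactor)
    (hC : C.IsOddCycle) (hD : D.IsOddCycle) (hCF : C ≤ F) (hDF : D ≤ F) {v : V}
    (hvC : v ∈ C.verts) (hvD : v ∈ D.verts) : C ≤ D := by
  classical
  have key : ∀ {a b : V} (p : G.Walk a b), (∀ e ∈ p.edges, e ∈ F.edgeSet) → a ∈ D.verts →
      ∀ x ∈ p.support, x ∈ D.verts := by
    intro a b p
    induction p with
    | nil =>
      intro _ ha x hx
      rw [Walk.support_nil, List.mem_singleton] at hx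
      exact hx ▸ ha
    | @cons a c b hadj p ih =>
      intro hp ha x hx
      rw [Walk.support_cons, List.mem_cons] at hx
      rcases hx with rfl | hx
      · exact ha
      · refine ih (fun e he => hp e (by simp [he])) ?_ x hx
        have hac : F.Adj a c := hp s(a, c) (by simp)
        exact D.edge_vert ((hF.adj_iff hD hDF ha).2 hac).symm
  have hverts : C.verts ⊆ D.verts := by
    obtain ⟨u, p, -, -, rfl⟩ := hC
    have hv : v ∈ p.support := p.mem_verts_toSubgraph.1 hvC
    intro x hx
    rw [← p.toSubgraph_rotate hv] at hx
    refine key (p.rotate v hv) (fun e he => ?_) hvD x (Walk.mem_verts_toSubgraph _ |>.1 hx)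
    rw [← Walk.mem_edges_toSubgraph, p.toSubgraph_rotate hv] at he
    exact Subgraph.edgeSet_mono hCF he
  exact ⟨hverts, fun a b hab => (hF.adj_iff hD hDF (hverts (C.edge_vert hab))).2 (hCF.2 hab)⟩

theorem Subgraph.IsTwoFactor.disjoint_edgeSet [Finite V] {F C D : G.Subgraph}
    (hF : F.IsTwoFactor) (hC : C.IsOddCycle) (hD : D.IsOddCycle) (hCF : C ≤ F) (hDF : D ≤ F)
    (hne : C ≠ D) : Disjoint C.edgeSet D.edgeSet := by
  rw [Set.disjoint_left]
  intro e heC heD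
  induction e with
  | _ a b =>
    have ha := C.edge_vert heC
    have ha' := D.edge_vert heD
    exact hne (le_antisymm (hF.le_of_mem_verts hC hD hCF hDF ha ha')
      (hF.le_of_mem_verts hD hC hDF hCF ha' ha))

/-- A set `S` of edges that contains all edges outside `F` and meets every odd cycle in `F` meets
every odd cycle, so that its deletion leaves a bipartite graph. -/
theorem Subgraph.isBipartite_deleteEdges {F : G.Subgraph} {S : Set (Sym2 V)}
    (hS : F.edgeComplement.edgeSet ⊆ S)
    (hit : ∀ C : G.Subgraph, C.IsOddCycle → C ≤ F → (C.edgeSet ∩ S).Nonempty) :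
    (G.deleteEdges S).IsBipartite := by
  refine two_colorable_iff_forall_loop_even.2 fun u w => ?_
  by_contra hodd
  obtain ⟨v, c, hc, hlen, -⟩ := w.exists_odd_isCycle (Nat.not_even_iff_odd.1 hodd)
  have hle := G.deleteEdges_le S
  have hedge : ∀ e ∈ (c.mapLe hle).edges, e ∉ S := by
    intro e he
    rw [Walk.edges_mapLe_eq_edges] at he
    have := c.edges_subset_edgeSet he
    rw [edgeSet_deleteEdges] at this
    exact this.2
  have hC : (c.mapLe hle).toSubgraph.IsOddCycle := ⟨v, _, hc.mapLe hle, by simpa using hlen, rfl⟩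
  have hCF : (c.mapLe hle).toSubgraph ≤ F := by
    rw [Walk.toSubgraph_le_iff (hc.mapLe hle).not_nil]
    intro e he
    have heG := (c.mapLe hle).edges_subset_edgeSet he
    induction e with
    | _ a b =>
      by_contra hF
      exact hedge _ he (hS ⟨heG, hF⟩)
  obtain ⟨e, he, heS⟩ := hit _ hC hCF
  exact hedge e ((Walk.mem_edges_toSubgraph _).1 he) heS

end SimpleGraph

open SimpleGraph in
theorem mainTheorem3 {V : Type*} [Fintype V] (G : SimpleGraph V) [DecidableRel G.Adj]
    (hcubic : G.IsRegularOfDegree 3) (hbridgeless : ∀ e ∈ G.edgeSet, ¬ G.IsBridge e)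
    (k : ℕ) (hk : 0 < k) :
    (∀ 𝒞 : Finset G.Subgraph,
      (∀ C ∈ 𝒞, C.IsOddCycle) →
      (∀ C ∈ 𝒞, ∀ D ∈ 𝒞, C ≠ D → Disjoint C.edgeSet D.edgeSet) →
      𝒞.card ≤ 5 ^ (k - 1) - 1 →
      ∃ M : Fin (k - 1) → G.Subgraph,
        (∀ j, (M j).IsPerfectMatching) ∧
        ∀ C ∈ 𝒞, ∃ j, (C.edgeSet ∩ (M j).edgeSet).Nonempty) ∧
    (G.oddness ≤ ((5 ^ (k - 1) - 1 : ℕ) : ℕ∞) →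
      ∃ M : Fin k → G.Subgraph,
        (∀ j, (M j).IsPerfectMatching) ∧
        (G.deleteEdges (⋃ j, (M j).edgeSet)).IsBipartite) := by
  refine ⟨fun 𝒞 hodd hdisj hcard => ?_, fun hodd => ?_⟩
  · obtain ⟨M, hM, hit⟩ :=
      exists_isPerfectMatching_meeting_odd_cycles hcubic hbridgeless (𝒞 : Set G.Subgraph) hodd hdisj
    refine ⟨fun _ => M, fun _ => hM, fun C hC => ?_⟩
    have hk1 : 0 < k - 1 := by
      by_contra h
      obtain h : k - 1 = 0 := by omega
      rw [h, pow_zero, Nat.sub_self, Nat.le_zero, Finset.card_eq_zero] at hcard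
      simp [hcard] at hC
    exact ⟨⟨0, hk1⟩, hit C hC⟩
  · obtain ⟨F, hF, hlt⟩ : ∃ F : G.Subgraph, F.IsTwoFactor ∧
        {C : G.Subgraph | C.IsOddCycle ∧ C ≤ F}.encard < ((5 ^ (k - 1) - 1 : ℕ) : ℕ∞) + 1 := by
      have h := hodd.trans_lt (ENat.natCast_lt_natCast.2 (Nat.lt_succ_self _))
      simpa [oddness, iInf_lt_iff] using h
    obtain ⟨M₁, hM₁, hit⟩ := exists_isPerfectMatching_meeting_odd_cycles hcubic hbridgeless
      {C : G.Subgraph | C.IsOddCycle ∧ C ≤ F} (fun C hC => hC.1)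
      fun C hC D hD hne => hF.disjoint_edgeSet hC.1 hD.1 hC.2 hD.2 hne
    refine ⟨fun j => if j.1 = 0 then F.edgeComplement else M₁, fun j => ?_, ?_⟩
    · dsimp only
      split_ifs
      exacts [hF.isPerfectMatching_edgeComplement hcubic, hM₁]
    · refine Subgraph.isBipartite_deleteEdges (F := F) ?_ fun C hC hCF => ?_
      · exact Set.subset_iUnion_of_subset (⟨0, hk⟩ : Fin k) (by simp)
      · have hk1 : 1 < k := by
          by_contra h
          obtain rfl : k = 1 := by omega
          have h0 : {C : G.Subgraph | C.IsOddCycle ∧ C ≤ F} = ∅ := by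
            simpa using hlt
          exact Set.eq_empty_iff_forall_notMem.1 h0 C ⟨hC, hCF⟩
        obtain ⟨e, he, heM⟩ := hit C ⟨hC, hCF⟩
        exact ⟨e, he, Set.mem_iUnion.2 ⟨⟨1, hk1⟩, by simpa using heM⟩⟩
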